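/- Let $n\ge 0$ be an integer. A state of the half-turn symmetric six-vertex model with domain wall boundary conditions (DWBC) on the $(2n)\times(2n)$ square lattice is an assignment of an arrow to each edge of the lattice (including the edges that cross its boundary) such that: at each vertex exactly two arrows point in and two point out (the ice rule); all arrows on the left and right boundaries point out of the lattice and all arrows on the top and bottom boundaries point into it; and the assignment is invariant under rotation of the lattice by $180^\circ$. A vertex is of type 1 if all its arrows point right or up, type 2 if all point left or down, type 3 if all point right or down, type 4 if all point left or up, type 5 if its horizontal arrows point out and its vertical arrows point in, and type 6 if its horizontal arrows point in and its vertical arrows point out. For vertex weights $w_1,\dots,w_6$, the partition function is $$Z_{2n}^{\rm HT}(w_1,\dots,w_6)=\sum_{\sigma}\ \prod_{x} w_{t(x;\sigma)},$$ where the sum is over all states $\sigma$, the product is over all vertices $x$, and $t(x;\sigma)$ is the type of $x$ in $\sigma$. Let $a=a(t)$, $b=b(t)$ and $c$ be given, for fixed real $\gamma$, by one of the parametrizations * (ferroelectric phase) $a=\sinh(t-\gamma)$, $b=\sinh(t+\gamma)$, $c=\sinh(2|\gamma|)$, with $0<|\gamma|<t$; * (anti-ferroelectric phase) $a=\sinh(\gamma-t)$,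 $b=\sinh(\gamma+t)$, $c=\sinh(2\gamma)$, with $|t|<\gamma$; * (disordered phase) $a=\sin(\gamma-t)$, $b=\sin(\gamma+t)$, $c=\sin(2\gamma)$, with $|t|<\gamma<\frac{\pi}{2}$. Then the partition function $Z_{2n}^{\rm HT}$ with weights $w_1=w_2=\sqrt a$, $w_3=w_4=\sqrt b$, $w_5=w_6=\sqrt c$ is $$Z_{2n}^{\rm HT}=\frac{(ab)^{2n^2}}{\prod_{j=0}^{n-1}(j!)^4}\,\tau_n^{\rm DW}\,\tau_n^{\rm HT},$$ where $$\tau_n^{\rm DW}=\det\left(\phi^{(j+k-2)}(t)\right)_{j,k=1}^n,\quad \phi(t)=\frac{c}{ab},\qquad \tau_n^{\rm HT}=\det\left(\psi^{(j+k-2)}(t)\right)_{j,k=1}^n,\quad \psi(t)=\frac1a+\frac1b,$$ and $\phi^{(m)}$, $\psi^{(m)}$ denote the $m$-th derivatives with respect to $t$ at fixed $\gamma$. -/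

import Mathlib

namespace SixVertex

/-- An assignment of arrows to all the edges of the `N × N` square lattice, including the edges
that cross its boundary. Rows are numbered from the top and columns from the left.
* `σ.1 i j` is the arrow on the `j`-th horizontal edge of row `i`, that is, the edge between the
  columns `j - 1` and `j`: `true` points right, `false` points left.
* `σ.2 i j` is the arrow on the `i`-th vertical edge of column `j`, that is, the edge between the
  rows `i - 1` and `i`: `true` points up, `false` points down.
So the vertex in row `i` and column `j` has left edge `σ.1 i j`, right edge `σ.1 i (j + 1)`,
top edge `σ.2 i j` and bottom edge `σ.2 (i + 1) j`. -/
abbrev ArrowConfig (N : ℕ) : Type :=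
  (Fin N → Fin (N + 1) → Bool) × (Fin (N + 1) → Fin N → Bool)

/-- The number of arrows that point into a vertex with the given arrows on its left, right, top
and bottom edge. -/
def inDegree (left right top bottom : Bool) : ℕ :=
  left.toNat + (!right).toNat + (!top).toNat + bottom.toNat

/-- The type of a vertex with the given arrows on its left, right, top and bottom edge;
type `k + 1` is `some k`, and `none` stands for a violation of the ice rule.
* types 1 and 2: all arrows point right or up; all arrows point left or down;
* types 3 and 4: all arrows point right or down; all arrows point left or up;
* type 5: horizontal arrows point out, vertical arrows point in;
* type 6: horizontal arrows point in, vertical arrows point out. -/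
def vertexType (left right top bottom : Bool) : Option (Fin 6) :=
  match left, right, top, bottom with
  | true, true, true, true => some 0
  | false, false, false, false => some 1
  | true, true, false, false => some 2
  | false, false, true, true => some 3
  | false, true, false, true => some 4
  | true, false, true, false => some 5
  | _, _, _, _ => none

/-- The six types are exactly the vertices allowed by the ice rule. -/
theorem inDegree_eq_two_iff (left right top bottom : Bool) :
    inDegree left right top bottom = 2 ↔ (vertexType left right top bottom).isSome := by
  revert left right top bottom
  decide

/-- The type of the vertex in row `i` and column `j`. -/
def typeAt {N : ℕ} (σ : ArrowConfig N) (i j : Fin N) : Option (Fin 6) :=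
  vertexType (σ.1 i j.castSucc) (σ.1 i j.succ) (σ.2 i.castSucc j) (σ.2 i.succ j)

/-- The ice rule: at each vertex exactly two of the four arrows point in (and so exactly two
point out). -/
def IceRule {N : ℕ} (σ : ArrowConfig N) : Prop :=
  ∀ i j : Fin N,
    inDegree (σ.1 i j.castSucc) (σ.1 i j.succ) (σ.2 i.castSucc j) (σ.2 i.succ j) = 2

/-- Domain wall boundary conditions: the arrows on the left and right boundaries point out of the
lattice, the arrows on the top and bottom boundaries point into it. -/
def DomainWall {N : ℕ} (σ : ArrowConfig N) : Prop :=
  (∀ i : Fin N, σ.1 i 0 = false ∧ σ.1 i (Fin.last N) = true) ∧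
    ∀ j : Fin N, σ.2 0 j = false ∧ σ.2 (Fin.last N) j = true

/-- The image of an arrow configuration under the rotation of the lattice by 180 degrees. The edge
with indices `i`, `j` comes from the one with the reversed indices, and its arrow is turned
around. -/
def rotate {N : ℕ} (σ : ArrowConfig N) : ArrowConfig N :=
  (fun i j => !σ.1 i.rev j.rev, fun i j => !σ.2 i.rev j.rev)

/-- The states of the half-turn symmetric model: the arrow configurations that obey the ice rule
and the domain wall boundary conditions and are invariant under rotation by 180 degrees. -/
def IsHalfTurnState {N : ℕ} (σ : ArrowConfig N) : Prop :=
  IceRule σ ∧ DomainWall σ ∧ rotate σ = σ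

instance {N : ℕ} : DecidablePred (IsHalfTurnState (N := N)) := fun σ => by
  unfold IsHalfTurnState IceRule DomainWall
  infer_instance

/-- The weight of a configuration: the product over all vertices of the weight of the type of the
vertex (`w k` is the weight of type `k + 1`). The value `0` for a vertex that violates the ice rule
plays no role for states. -/
def weight {N : ℕ} (w : Fin 6 → ℝ) (σ : ArrowConfig N) : ℝ :=
  ∏ i : Fin N, ∏ j : Fin N, (typeAt σ i j).elim 0 w

/-- The partition function of the half-turn symmetric six-vertex model with domain wall boundary
conditions on the `(2n) × (2n)` lattice with vertex weights `w`. -/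
def partitionHT (n : ℕ) (w : Fin 6 → ℝ) : ℝ :=
  ∑ σ : ArrowConfig (2 * n) with IsHalfTurnState σ, weight w σ

/-- The `n × n` Hankel determinant of the derivatives of `f` at `t`: with indices starting at `0`,
the entry at `j`, `k` is the derivative of order `j + k`. -/
noncomputable def hankelDet (n : ℕ) (f : ℝ → ℝ) (t : ℝ) : ℝ :=
  (Matrix.of fun j k : Fin n => iteratedDeriv ((j : ℕ) + (k : ℕ)) f t).det

/-- Parametrization of the weights in the ferroelectric phase, as functions of `t` for fixed `γ`. -/
def Ferroelectric (γ t : ℝ) (a b : ℝ → ℝ) (c : ℝ) : Prop :=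
  0 < |γ| ∧ |γ| < t ∧ a = (fun s => Real.sinh (s - γ)) ∧ b = (fun s => Real.sinh (s + γ)) ∧
    c = Real.sinh (2 * |γ|)

/-- Parametrization of the weights in the anti-ferroelectric phase. -/
def AntiFerroelectric (γ t : ℝ) (a b : ℝ → ℝ) (c : ℝ) : Prop :=
  |t| < γ ∧ a = (fun s => Real.sinh (γ - s)) ∧ b = (fun s => Real.sinh (γ + s)) ∧
    c = Real.sinh (2 * γ)

/-- Parametrization of the weights in the disordered phase. -/
def Disordered (γ t : ℝ) (a b : ℝ → ℝ) (c : ℝ) : Prop :=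
  |t| < γ ∧ γ < Real.pi / 2 ∧ a = (fun s => Real.sin (γ - s)) ∧ b = (fun s => Real.sin (γ + s)) ∧
    c = Real.sin (2 * γ)

end SixVertex

/-!
A half-turn symmetric state is determined by the upper half of the lattice. There the middle line
only asks that arrows in mirror columns be opposite, and each vertex together with its image under
the rotation contributes the full weight `a`, `b` or `c`. The partition function is therefore an
entry sum of a product of row-to-row transfer matrices with the weights `a`, `b`, `c`
(`partitionHT_eq_homogeneousZ`).

The evaluation follows the method of Izergin, Korepin and Kuperberg. Give the `i`-th row a
parameter `U i`, and give both the `j`-th column from the left and the `j`-th from the right the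
parameter `V j`. In multiplicative form the weights are `a = p u - q y`, `b = q u - p y` with
`p q = 1`, and the product of the weights of types 5 and 6 is `(q ^ 2 - p ^ 2) ^ 2 u y`. The claim
is `Z * Δ(U) ^ 2 * Δ(V) ^ 2 = (∏ a b) ^ 2 * det (1 / (a b)) * det (1 / a + 1 / b)`
with `Δ` the Vandermonde determinant (`detFormula`). It is proved by induction on the size, from
four properties of `Z`:

* it is symmetric in `U`, because the transfer matrices commute by the Yang–Baxter equation
  (`commute_spectralTransfer`);
* reflecting the lattice interchanges `a` and `b`, that is `p` and `q` (`inhomogeneousZ_swap`);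
* it is a polynomial in `V 0` of degree less than the number of vertices in the two outermost
  columns, since one of them is of type 5 (`exists_polynomial_inhomogeneousZ`);
* at a zero of the corner weight `a` the outermost rows and columns freeze, which leaves the
  partition function of the next smaller lattice (`inhomogeneousZ_frozen`).

The first, second and fourth property give `Z` at all zeros of the weights in the first column, as a
polynomial in `V 0`. On the other side, the two determinants, with the denominators of the first
column cleared, are polynomials in `V 0` that both vanish at the other `V j`. Removing these common
roots leaves polynomials of low enough degree to be compared at the nodes (`mul_eq_of_nodes`). No
partition function without the half-turn symmetry is needed: the factor `det (1 / (a b))` enters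
only as a determinant.

For the homogeneous limit the additive parameters are `t + ε i` for the rows and `-ε j` for the
columns, so that the determinants become Hankel determinants of values of `c / (a b)` and
`1 / a + 1 / b` at `t + ε (i + j)`. Unimodular row and column operations turn these values into
forward differences, whose quotients by powers of `ε` converge to derivatives
(`tendsto_det_hankel`). The three phases are specializations of the complex parameters
(`partitionHT_eq_of_parametrization`).
-/

namespace SixVertex

open Matrix Filter Topology Asymptotics
open scoped Kronecker

/-! ### Transfer matrices -/

/-- The matrix of Boltzmann weights of a vertex, with weights `a` for types 1 and 2, `b` for
types 3 and 4, `c` for type 5 and `d` for type 6. The arrows on the top and bottom edge are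
arguments, the arrows on the left and right edge are the row and column index. -/
def vertexOp {K : Type*} [Zero K] (a b c d : K) (top bottom : Bool) : Matrix Bool Bool K :=
  Matrix.of fun l r => (vertexType l r top bottom).elim 0 ![a, a, b, b, c, d]

/-- The weight of a row of `2n` vertices with vertical arrows `s` above and `s'` below, as a
matrix in the arrows on the leftmost and rightmost edge. The columns are grouped into mirror
pairs, from the outside in: `(s j).1` is the arrow in the `j`-th column from the left and `(s j).2`
the one in the `j`-th column from the right. Both columns carry the vertex operator `L j`. -/
def rowOp {K : Type*} [CommRing K] : (n : ℕ) → (Fin n → Bool → Bool → Matrix Bool Bool K) →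
    (Fin n → Bool × Bool) → (Fin n → Bool × Bool) → Matrix Bool Bool K
  | 0, _, _, _ => 1
  | n + 1, L, s, s' => L 0 (s 0).1 (s' 0).1 *
      rowOp n (fun j => L j.succ) (fun j => s j.succ) (fun j => s' j.succ) *
      L 0 (s 0).2 (s' 0).2

/-- The row-to-row transfer matrix with the horizontal boundary arrows pointing out. -/
def transfer {K : Type*} [CommRing K] {n : ℕ} (L : Fin n → Bool → Bool → Matrix Bool Bool K) :
    Matrix (Fin n → Bool × Bool) (Fin n → Bool × Bool) K :=
  Matrix.of fun s s' => rowOp n L s s' false true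

/-- The partition function of the upper half of a half-turn symmetric lattice with the given
transfer matrices: the arrows on top point down, and on the middle line the arrows in mirror
columns are opposite. -/
def halfTurnSum {K : Type*} [CommRing K] {n : ℕ}
    (T : List (Matrix (Fin n → Bool × Bool) (Fin n → Bool × Bool) K)) : K :=
  ∑ g : Fin n → Bool, T.prod (fun _ => (false, false)) fun j => (g j, !g j)

/-- The vertex operator in multiplicative spectral parameters: `u` belongs to the row, `y` to the
column, and `p`, `q` are mutually inverse. The weights of types 5 and 6 are not symmetric, only
their product matters; this choice makes all weights polynomial in `y`. -/
def spectralOp {K : Type*} [CommRing K] (p q u y : K) : Bool → Bool → Matrix Bool Bool K :=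
  vertexOp (p * u - q * y) (q * u - p * y) 1 ((q ^ 2 - p ^ 2) ^ 2 * u * y)

/-- The transfer matrix with row parameter `u` and column parameters `V`. -/
def spectralTransfer {K : Type*} [CommRing K] {n : ℕ} (p q : K) (V : Fin n → K) (u : K) :
    Matrix (Fin n → Bool × Bool) (Fin n → Bool × Bool) K :=
  transfer fun j => spectralOp p q u (V j)

/-- The inhomogeneous half-turn symmetric partition function with row parameters `U` and column
parameters `V`. -/
def inhomogeneousZ {K : Type*} [CommRing K] {n : ℕ} (p q : K) (U V : Fin n → K) : K :=
  halfTurnSum (List.ofFn fun i => spectralTransfer p q V (U i))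

theorem sum_cons {α M : Type*} [Fintype α] [AddCommMonoid M] {n : ℕ}
    (f : (Fin (n + 1) → α) → M) :
    ∑ s, f s = ∑ x : α, ∑ s : Fin n → α, f (Fin.cons x s) := by
  rw [← Fintype.sum_prod_type']
  exact (Fintype.sum_equiv (Fin.consEquiv fun _ => α) _ _ fun _ => rfl).symm

/-! ### Yang–Baxter equation -/

/-- A local intertwining relation extends to whole rows (train argument). -/
theorem intertwine_rowOp {K : Type*} [CommRing K] (R : Matrix (Bool × Bool) (Bool × Bool) K) :
    ∀ {n : ℕ} (L L' : Fin n → Bool → Bool → Matrix Bool Bool K)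
      (_ : ∀ j t b, R * ∑ m, (L j t m) ⊗ₖ (L' j m b) =
        (∑ m, (L' j t m) ⊗ₖ (L j m b)) * R)
      (s s' : Fin n → Bool × Bool),
      R * ∑ m, (rowOp n L s m) ⊗ₖ (rowOp n L' m s') =
        (∑ m, (rowOp n L' s m) ⊗ₖ (rowOp n L m s')) * R
  | 0, L, L', _, s, s' => by simp [rowOp]
  | n + 1, L, L', h, s, s' => by
    have key : ∀ L L' : Fin (n + 1) → Bool → Bool → Matrix Bool Bool K,
        ∑ m, (rowOp (n + 1) L s m) ⊗ₖ (rowOp (n + 1) L' m s') =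
        (∑ m, (L 0 (s 0).1 m) ⊗ₖ (L' 0 m (s' 0).1)) *
        (∑ m, rowOp n (fun j => L j.succ) (fun j => s j.succ) m ⊗ₖ
          rowOp n (fun j => L' j.succ) m (fun j => s' j.succ)) *
        (∑ m, (L 0 (s 0).2 m) ⊗ₖ (L' 0 m (s' 0).2)) := by
      intro L L'
      rw [sum_cons, Fintype.sum_prod_type]
      simp only [rowOp, Fin.cons_zero, Fin.cons_succ, mul_kronecker_mul, Finset.sum_mul,
        Finset.mul_sum]
      rw [Finset.sum_comm]
      refine Finset.sum_congr rfl fun x _ => ?_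
      rw [Finset.sum_comm]
    rw [key, key, ← mul_assoc, ← mul_assoc, h, mul_assoc _ R,
      intertwine_rowOp R (fun j => L j.succ) (fun j => L' j.succ) (fun j => h j.succ),
      ← mul_assoc, mul_assoc _ R, h, ← mul_assoc]

/-- The intertwiner of two rows with parameters `u` and `u'` in the Yang–Baxter equation. It is a
six-vertex matrix acting on the pairs of horizontal arrows of the two rows. -/
def intertwiner {K : Type*} [CommRing K] (p q u u' : K) :
    Matrix (Bool × Bool) (Bool × Bool) K :=
  Matrix.of fun x y => match x, y with
    | (false, false), (false, false) => q ^ 2 * u - p ^ 2 * u'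
    | (true, true), (true, true) => q ^ 2 * u - p ^ 2 * u'
    | (false, true), (false, true) => (q ^ 2 - p ^ 2) * u
    | (true, false), (true, false) => (q ^ 2 - p ^ 2) * u'
    | (false, true), (true, false) => u - u'
    | (true, false), (false, true) => u - u'
    | _, _ => 0

set_option maxHeartbeats 1000000 in
theorem yangBaxter {K : Type*} [CommRing K] {p q : K} (h : p * q = 1) (u u' y : K) (t b : Bool) :
    intertwiner p q u u' * ∑ m, (spectralOp p q u y t m) ⊗ₖ (spectralOp p q u' y m b) =
      (∑ m, (spectralOp p q u' y t m) ⊗ₖ (spectralOp p q u y m b)) *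
        intertwiner p q u u' := by
  ext ⟨l₁, l₂⟩ ⟨r₁, r₂⟩
  simp only [mul_apply, Matrix.add_apply, Fintype.sum_prod_type, Fintype.sum_bool,
    kroneckerMap_apply]
  cases t <;> cases b <;> cases l₁ <;> cases l₂ <;> cases r₁ <;> cases r₂ <;>
    simp [spectralOp, vertexOp, vertexType, intertwiner] <;> grind

/-- On the boundary, where the horizontal arrows of both rows point out, the intertwiner acts as the
scalar `q ^ 2 * u - p ^ 2 * u'`, which cancels. -/
theorem commute_spectralTransfer {K : Type*} [CommRing K] [IsDomain K] {p q : K} (h : p * q = 1)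
    {n : ℕ} (V : Fin n → K) (u u' : K) (hu : q ^ 2 * u - p ^ 2 * u' ≠ 0) :
    Commute (spectralTransfer p q V u) (spectralTransfer p q V u') := by
  ext s s'
  have := congrFun (congrFun (intertwine_rowOp (intertwiner p q u u')
    (fun j => spectralOp p q u (V j)) (fun j => spectralOp p q u' (V j))
    (fun j t b => yangBaxter h u u' (V j) t b) s s') (false, false)) (true, true)
  simp only [mul_apply, Matrix.sum_apply, Fintype.sum_prod_type, Fintype.sum_bool,
    kroneckerMap_apply] at this
  simp only [intertwiner, of_apply, zero_mul, mul_zero, add_zero, zero_add] at this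
  rw [mul_comm _ (q ^ 2 * u - p ^ 2 * u')] at this
  exact mul_left_cancel₀ hu this

/-! ### Symmetries of the inhomogeneous partition function -/

theorem inhomogeneousZ_comp_perm {K : Type*} [CommRing K] [IsDomain K] {p q : K} (h : p * q = 1)
    {n : ℕ} (U V : Fin n → K) (hU : ∀ i j, q ^ 2 * U i - p ^ 2 * U j ≠ 0)
    (σ : Equiv.Perm (Fin n)) :
    inhomogeneousZ p q (U ∘ σ) V = inhomogeneousZ p q U V := by
  unfold inhomogeneousZ halfTurnSum
  have := (Equiv.Perm.ofFn_comp_perm σ (fun i => spectralTransfer p q V (U i))).prod_eq' (by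
    rw [List.pairwise_ofFn]
    intro i j _
    exact commute_spectralTransfer h V _ _ (hU _ _))
  simp only [Function.comp_def] at this ⊢
  rw [this]

theorem vertexOp_reflect {K : Type*} [Zero K] (a b c d : K) (t m l r : Bool) :
    vertexOp b a c d t m l r = vertexOp a b c d t m (!r) (!l) := by
  cases t <;> cases m <;> cases l <;> cases r <;> simp [vertexOp, vertexType]

theorem rowOp_reflect {K : Type*} [CommRing K] : ∀ {n : ℕ}
    (L L' : Fin n → Bool → Bool → Matrix Bool Bool K)
    (_ : ∀ j t m l r, L' j t m l r = L j t m (!r) (!l)) (s s' : Fin n → Bool × Bool) (l r : Bool),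
    rowOp n L' s s' l r = rowOp n L (fun j => (s j).swap) (fun j => (s' j).swap) (!r) (!l)
  | 0, _, _, _, _, _, l, r => by cases l <;> cases r <;> simp [rowOp]
  | n + 1, L, L', h, s, s', l, r => by
    simp only [rowOp, mul_apply, Fintype.sum_bool, h, Prod.fst_swap, Prod.snd_swap,
      rowOp_reflect (fun j => L j.succ) (fun j => L' j.succ) (fun j => h j.succ),
      Bool.not_true, Bool.not_false]
    ring

theorem prod_map_submatrix {ι K : Type*} [Fintype ι] [DecidableEq ι] [CommRing K]
    (e : Equiv.Perm ι) (T : List (Matrix ι ι K)) :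
    (T.map fun M => M.submatrix e e).prod = T.prod.submatrix e e := by
  induction T with
  | nil => simp
  | cons M T ih => simp [ih, submatrix_mul_equiv]

/-- Reflecting the lattice in its vertical axis interchanges the weights `a` and `b`, which amounts
to interchanging `p` and `q`. -/
theorem inhomogeneousZ_swap {K : Type*} [CommRing K] {n : ℕ} (p q : K) (U V : Fin n → K) :
    inhomogeneousZ q p U V = inhomogeneousZ p q U V := by
  let e : Equiv.Perm (Fin n → Bool × Bool) := Equiv.piCongrRight fun _ => Equiv.prodComm _ _
  have hT : ∀ u, spectralTransfer q p V u = (spectralTransfer p q V u).submatrix e e := by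
    intro u
    ext s s'
    refine (rowOp_reflect (fun j => spectralOp p q u (V j)) (fun j => spectralOp q p u (V j))
      ?_ s s' false true).trans rfl
    intro j t m l r
    simp only [spectralOp]
    rw [← vertexOp_reflect, show (p ^ 2 - q ^ 2) ^ 2 = (q ^ 2 - p ^ 2) ^ 2 by ring]
  unfold inhomogeneousZ halfTurnSum
  have : (List.ofFn fun i => spectralTransfer q p V (U i)) =
      (List.ofFn fun i => spectralTransfer p q V (U i)).map fun M => M.submatrix e e := by
    rw [List.map_ofFn]
    congr 1
    funext i
    exact hT _
  rw [this, prod_map_submatrix]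
  refine Fintype.sum_equiv (Equiv.piCongrRight fun _ => Equiv.boolNot) _ _ fun g => ?_
  have hg : e (fun j => (g j, !g j)) = fun j => (!g j, !!g j) := by
    funext j
    simp [e]
  rw [submatrix_apply, hg]
  rfl

/-! ### Frozen corner -/

/-- A row with down arrows above and a right arrow entering from the left is frozen: all its
vertices are of type 3. -/
theorem rowOp_left_true {K : Type*} [CommRing K] : ∀ {n : ℕ} (a b c d : Fin n → K)
    (s' : Fin n → Bool × Bool) (r : Bool),
    rowOp n (fun j => vertexOp (a j) (b j) (c j) (d j)) (fun _ => (false, false)) s' true r =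
      if r = true ∧ s' = fun _ => (false, false) then ∏ j, b j ^ 2 else 0
  | 0, _, _, _, _, s', r => by
    have : s' = fun _ => (false, false) := Subsingleton.elim _ _
    cases r <;> simp [rowOp, this]
  | n + 1, a, b, c, d, s', r => by
    obtain ⟨⟨x, y⟩, s, rfl⟩ : ∃ x s, s' = Fin.cons x s := ⟨_, _, (Fin.cons_self_tail s').symm⟩
    have hc : (Fin.cons (x, y) s : Fin (n + 1) → Bool × Bool) = (fun _ => (false, false)) ↔
        (x = false ∧ y = false) ∧ s = fun _ => (false, false) := by
      constructor
      · intro h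
        refine ⟨by simpa using congrFun h 0, funext fun j => by simpa using congrFun h j.succ⟩
      · rintro ⟨⟨rfl, rfl⟩, rfl⟩
        funext j
        refine Fin.cases ?_ ?_ j <;> simp
    simp only [rowOp, mul_apply, Fintype.sum_bool, Fin.cons_zero, Fin.cons_succ, hc,
      Fin.prod_univ_succ,
      rowOp_left_true (fun j => a j.succ) (fun j => b j.succ) (fun j => c j.succ)
        (fun j => d j.succ)]
    by_cases hs : s = fun _ => (false, false) <;>
    cases x <;> cases y <;> cases r <;> simp [vertexOp, vertexType, hs] <;> ring

/-- If the corner vertex has `a = 0`, then the top row is frozen. -/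
theorem transfer_frozen {K : Type*} [CommRing K] {n : ℕ} (a b c d : Fin (n + 1) → K)
    (ha : a 0 = 0) (hc : c 0 = 1) (x : Bool × Bool) (s : Fin n → Bool × Bool) :
    transfer (fun j => vertexOp (a j) (b j) (c j) (d j)) (fun _ => (false, false))
      (Fin.cons x s) =
      if x = (true, false) ∧ s = fun _ => (false, false) then
        b 0 * ∏ j : Fin n, b j.succ ^ 2 else 0 := by
  obtain ⟨x, y⟩ := x
  simp only [transfer, of_apply, rowOp, mul_apply, Fintype.sum_bool, Fin.cons_zero, Fin.cons_succ,
      rowOp_left_true (fun j => a j.succ) (fun j => b j.succ) (fun j => c j.succ)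
        (fun j => d j.succ), ha, hc]
  by_cases hs : s = fun _ => (false, false) <;>
    cases x <;> cases y <;> simp [vertexOp, vertexType, hs] <;> ring

/-- Below a frozen corner: arrows pointing up in the outermost columns persist, and as long as the
outermost columns are in the state `(true, false)` they contribute weights `b`. -/
theorem transfer_outer {K : Type*} [CommRing K] {n : ℕ} (a b c d : Fin (n + 1) → K)
    (x : Bool × Bool) (s s' : Fin n → Bool × Bool) :
    (x ≠ (true, true) → transfer (fun j => vertexOp (a j) (b j) (c j) (d j))
      (Fin.cons (true, true) s) (Fin.cons x s') = 0) ∧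
    (x.1 = false → transfer (fun j => vertexOp (a j) (b j) (c j) (d j))
      (Fin.cons (true, false) s) (Fin.cons x s') = 0) ∧
    transfer (fun j => vertexOp (a j) (b j) (c j) (d j))
      (Fin.cons (true, false) s) (Fin.cons (true, false) s') =
      b 0 ^ 2 * transfer (fun j : Fin n => vertexOp (a j.succ) (b j.succ) (c j.succ) (d j.succ))
        s s' := by
  obtain ⟨x, y⟩ := x
  simp only [transfer, of_apply, rowOp, mul_apply, Fintype.sum_bool, Fin.cons_zero, Fin.cons_succ]
  refine ⟨?_, ?_, ?_⟩
  · cases x <;> cases y <;> simp [vertexOp, vertexType]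
  · cases x <;> cases y <;> simp [vertexOp, vertexType]
  · simp [vertexOp, vertexType]
    ring

/-- The rows below a frozen top row, for a final state that has opposite arrows in the outermost
columns: only states with `(true, false)` in these columns throughout contribute. -/
theorem prod_outer {K : Type*} [CommRing K] {n : ℕ} (p q : K) (V : Fin (n + 1) → K)
    (us : List K) (s s' : Fin n → Bool × Bool) (x : Bool) :
    (us.map (spectralTransfer p q V)).prod (Fin.cons (true, true) s) (Fin.cons (x, !x) s') = 0 ∧
    (us.map (spectralTransfer p q V)).prod (Fin.cons (true, false) s) (Fin.cons (x, !x) s') =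
      if x then (us.map fun u => (q * u - p * V 0) ^ 2).prod *
        (us.map (spectralTransfer p q fun j => V j.succ)).prod s s' else 0 := by
  induction us generalizing s with
  | nil =>
    have h : ∀ x y : Bool × Bool, (Fin.cons x s : Fin (n + 1) → Bool × Bool) = Fin.cons y s' ↔
        x = y ∧ s = s' := fun x y => Fin.cons_inj
    cases x <;> simp [one_apply, h]
  | cons u us ih =>
    obtain ⟨h1, h2, h3⟩ : _ ∧ _ ∧ _ := ⟨
      fun x s s' => (transfer_outer (fun j => p * u - q * V j) (fun j => q * u - p * V j)
        (fun _ => 1) (fun j => (q ^ 2 - p ^ 2) ^ 2 * u * V j) x s s').1,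
      fun x s s' => (transfer_outer (fun j => p * u - q * V j) (fun j => q * u - p * V j)
        (fun _ => 1) (fun j => (q ^ 2 - p ^ 2) ^ 2 * u * V j) x s s').2.1,
      fun s s' => (transfer_outer (fun j => p * u - q * V j) (fun j => q * u - p * V j)
        (fun _ => 1) (fun j => (q ^ 2 - p ^ 2) ^ 2 * u * V j) default s s').2.2⟩
    change ∀ x s s', _ → spectralTransfer p q V u _ _ = _ at h1
    change ∀ x s s', _ → spectralTransfer p q V u _ _ = _ at h2
    change ∀ s s', spectralTransfer p q V u _ _ =
      _ * spectralTransfer p q (fun j => V j.succ) u _ _ at h3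
    simp only [List.map_cons, List.prod_cons]
    rw [mul_apply, mul_apply, mul_apply, sum_cons, sum_cons]
    simp only [Fintype.sum_prod_type, Fintype.sum_bool]
    constructor
    · simp only [(ih _).1, h1 (true, false) _ _ (by simp), h1 (false, true) _ _ (by simp),
        h1 (false, false) _ _ (by simp), mul_zero, zero_mul, Finset.sum_const_zero, add_zero]
    · simp only [(ih _).1, (ih _).2, h2 (false, true) _ _ rfl, h2 (false, false) _ _ rfl, h3,
        mul_zero, zero_mul, Finset.sum_const_zero, add_zero, zero_add]
      cases x
      · simp
      · simp only [if_true, Finset.mul_sum]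
        exact Finset.sum_congr rfl fun t _ => by ring

/-- If the corner vertex has `a = 0`, the outermost rows and columns freeze, and what is left is the
partition function of the next smaller lattice. -/
theorem inhomogeneousZ_frozen {K : Type*} [CommRing K] {n : ℕ} (p q : K) (U V : Fin (n + 1) → K)
    (h : p * U 0 - q * V 0 = 0) :
    inhomogeneousZ p q U V = (q * U 0 - p * V 0) * (∏ j : Fin n, (q * U 0 - p * V j.succ) ^ 2) *
      (∏ i : Fin n, (q * U i.succ - p * V 0) ^ 2) *
      inhomogeneousZ p q (fun i : Fin n => U i.succ) fun j : Fin n => V j.succ := by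
  have h0 : ∀ x s, spectralTransfer p q V (U 0) (fun _ => (false, false)) (Fin.cons x s) = _ :=
    transfer_frozen (fun j => p * U 0 - q * V j) (fun j => q * U 0 - p * V j)
        (fun _ => 1) (fun j => (q ^ 2 - p ^ 2) ^ 2 * U 0 * V j) h rfl
  have key : ∀ (x : Bool) (s' : Fin n → Bool × Bool),
      (List.ofFn fun i => spectralTransfer p q V (U i)).prod (fun _ => (false, false))
        (Fin.cons (x, !x) s') = if x then
        (q * U 0 - p * V 0) * (∏ j : Fin n, (q * U 0 - p * V j.succ) ^ 2) *
        ((∏ i : Fin n, (q * U i.succ - p * V 0) ^ 2) *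
        (List.ofFn fun i : Fin n => spectralTransfer p q (fun j : Fin n => V j.succ)
          (U i.succ)).prod (fun _ => (false, false)) s') else 0 := by
    intro x s'
    have hl := (prod_outer p q V (List.ofFn fun i : Fin n => U i.succ)
      (fun _ => (false, false)) s' x).2
    simp only [List.map_ofFn, Function.comp_def] at hl
    rw [List.ofFn_succ, List.prod_cons, mul_apply, sum_cons, Fintype.sum_prod_type]
    simp only [Fintype.sum_bool, h0]
    simp only [Prod.mk.injEq, true_and, and_true, Bool.false_eq_true, Bool.true_eq_false,
      false_and, and_false, if_false, zero_mul, Finset.sum_const_zero, zero_add, add_zero,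
      ite_mul, Finset.sum_ite_eq', Finset.mem_univ, if_true]
    rw [hl]
    cases x <;> simp [List.prod_ofFn]
  have hg : ∀ (x : Bool) (g : Fin n → Bool),
      (fun j => ((Fin.cons x g : Fin (n + 1) → Bool) j, !(Fin.cons x g : Fin (n + 1) → Bool) j)) =
      (Fin.cons (x, !x) fun j => (g j, !g j) : Fin (n + 1) → Bool × Bool) := by
    intro x g
    funext j
    refine Fin.cases ?_ ?_ j <;> simp
  unfold inhomogeneousZ halfTurnSum
  rw [sum_cons]
  simp only [Fintype.sum_bool, hg, key, if_true, Bool.false_eq_true, if_false,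
    Finset.sum_const_zero, add_zero, ← Finset.mul_sum]
  ring

/-! ### Degree in a column parameter -/

/-- `f` is a polynomial function of degree at most `d - k`, hence zero if `d < k`. Stated with a
factor `X ^ k` to avoid subtraction. -/
def PolyDeg {K : Type*} [Field K] (k d : ℕ) (f : K → K) : Prop :=
  ∃ P : Polynomial K, (P * Polynomial.X ^ k).natDegree ≤ d ∧ ∀ x, P.eval x = f x

namespace PolyDeg

variable {K : Type*} [Field K] {k d k' d' : ℕ} {f g : K → K}

theorem const (k : ℕ) (c : K) : PolyDeg k k fun _ => c :=
  ⟨Polynomial.C c, Polynomial.natDegree_C_mul_X_pow_le c k, fun _ => Polynomial.eval_C⟩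

theorem zero (k d : ℕ) : PolyDeg k d fun _ : K => 0 := ⟨0, by simp, by simp⟩

theorem linear (c c' : K) : PolyDeg 0 1 fun x => c * x + c' :=
  ⟨Polynomial.C c * Polynomial.X + Polynomial.C c', by
    rw [pow_zero, mul_one]
    exact Polynomial.natDegree_linear_le, by simp⟩

theorem mul (hf : PolyDeg k d f) (hg : PolyDeg k' d' g) :
    PolyDeg (k + k') (d + d') fun x => f x * g x := by
  obtain ⟨P, hP, hPf⟩ := hf
  obtain ⟨Q, hQ, hQg⟩ := hg
  refine ⟨P * Q, ?_, fun x => by simp [hPf, hQg]⟩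
  rw [show P * Q * Polynomial.X ^ (k + k') =
    (P * Polynomial.X ^ k) * (Q * Polynomial.X ^ k') by ring]
  exact Polynomial.natDegree_mul_le_of_le hP hQ

theorem sum {ι : Type*} (s : Finset ι) {F : ι → K → K} (h : ∀ i ∈ s, PolyDeg k d (F i)) :
    PolyDeg k d fun x => ∑ i ∈ s, F i x := by
  choose! P hP hPF using h
  refine ⟨∑ i ∈ s, P i, ?_, fun x => ?_⟩
  · rw [Finset.sum_mul]
    exact Polynomial.natDegree_sum_le_of_forall_le s _ hP
  · rw [Polynomial.eval_finsetSum]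
    exact Finset.sum_congr rfl fun i hi => hPF i hi x

theorem cancel (m : ℕ) (h : PolyDeg (k + m) (d + m) f) : PolyDeg k d f := by
  obtain ⟨P, hP, hPf⟩ := h
  refine ⟨P, ?_, hPf⟩
  by_cases h0 : P = 0
  · simp [h0]
  · rw [pow_add, ← mul_assoc, Polynomial.natDegree_mul_X_pow _ (by simpa using h0)] at hP
    omega

theorem add_both (m : ℕ) (h : PolyDeg k d f) : PolyDeg (k + m) (d + m) f := by
  simpa using h.mul (const m 1)

end PolyDeg

/-- The number of up arrows in the two outermost columns. -/
def outerUp {n : ℕ} (s : Fin (n + 1) → Bool × Bool) : ℕ := (s 0).1.toNat + (s 0).2.toNat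

/-- The degree of a vertex weight in the column parameter is at most `1`, and it drops by one
where the vertical arrow changes from down to up. -/
theorem polyDeg_spectralOp {K : Type*} [Field K] (p q u : K) (t m l r : Bool) :
    PolyDeg m.toNat (t.toNat + 1) fun y => spectralOp p q u y t m l r := by
  have ha : PolyDeg 0 1 fun y => p * u - q * y := by
    convert PolyDeg.linear (-q) (p * u) using 2
    ring
  have hb : PolyDeg 0 1 fun y => q * u - p * y := by
    convert PolyDeg.linear (-p) (q * u) using 2
    ring
  have hd : PolyDeg 0 2 fun y => (q ^ 2 - p ^ 2) ^ 2 * u * y := by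
    obtain ⟨P, hP, h⟩ := PolyDeg.linear ((q ^ 2 - p ^ 2) ^ 2 * u) 0
    exact ⟨P, hP.trans one_le_two, by simpa using h⟩
  cases t <;> cases m <;> cases l <;> cases r <;> simp [spectralOp, vertexOp, vertexType] <;>
    first | exact PolyDeg.zero _ _ | exact ha | exact hb | exact hd | exact PolyDeg.const 1 1 |
      exact ha.add_both 1 | exact hb.add_both 1

theorem polyDeg_spectralTransfer {K : Type*} [Field K] {n : ℕ} (p q u : K) (V : Fin n → K)
    (s s' : Fin (n + 1) → Bool × Bool) :
    PolyDeg (outerUp s') (outerUp s + 2) fun y => spectralTransfer p q (Fin.cons y V) u s s' := by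
  simp only [spectralTransfer, transfer, of_apply, rowOp, mul_apply, Finset.sum_mul,
    Fin.cons_zero, Fin.cons_succ]
  refine PolyDeg.sum _ fun x _ => PolyDeg.sum _ fun z _ => ?_
  convert ((polyDeg_spectralOp p q u (s 0).1 (s' 0).1 false z).mul (PolyDeg.const 0 _)).mul
    (polyDeg_spectralOp p q u (s 0).2 (s' 0).2 x true) using 1
  all_goals
    simp only [outerUp]
    ring

theorem polyDeg_prod {K : Type*} [Field K] {n : ℕ} (p q : K) (V : Fin n → K) (us : List K)
    (s s' : Fin (n + 1) → Bool × Bool) :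
    PolyDeg (outerUp s') (outerUp s + 2 * us.length) fun y =>
      (us.map (spectralTransfer p q (Fin.cons y V))).prod s s' := by
  induction us generalizing s with
  | nil =>
    by_cases h : s = s'
    · subst h
      simpa using PolyDeg.const _ 1
    · simpa [one_apply, h] using PolyDeg.zero _ _
  | cons u us ih =>
    simp only [List.map_cons, List.prod_cons, mul_apply, List.length_cons]
    refine PolyDeg.sum _ fun t _ => PolyDeg.cancel (outerUp t) ?_
    convert (polyDeg_spectralTransfer p q u V s t).mul (ih t) using 1 <;> ring

/-- Every state has a vertex of type 5, which has constant weight, in the outermost columns; so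
the degree in the parameter of these columns is less than their number of vertices. -/
theorem exists_polynomial_inhomogeneousZ {K : Type*} [Field K] {n : ℕ} (p q : K)
    (U : Fin (n + 1) → K) (V : Fin n → K) :
    ∃ P : Polynomial K, P.natDegree ≤ 2 * n + 1 ∧
      ∀ y, P.eval y = inhomogeneousZ p q U (Fin.cons y V) := by
  have : PolyDeg 0 (2 * n + 1) fun y => inhomogeneousZ p q U (Fin.cons y V) := by
    refine PolyDeg.sum _ fun g _ => ?_
    have h := polyDeg_prod p q V (List.ofFn U) (fun _ => (false, false)) fun j => (g j, !g j)
    have h1 : outerUp (fun j : Fin (n + 1) => (g j, !g j)) = 0 + 1 := by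
      simp only [outerUp]
      cases g 0 <;> rfl
    have h2 : outerUp (fun _ : Fin (n + 1) => (false, false)) + 2 * (List.ofFn U).length =
        (2 * n + 1) + 1 := by
      simp [outerUp]
      ring
    rw [h1, h2] at h
    simpa only [List.map_ofFn, Function.comp_def] using h.cancel 1
  obtain ⟨P, hP, h⟩ := this
  exact ⟨P, by simpa using hP, h⟩

/-! ### Determinants with a distinguished column -/

theorem det_cons {K : Type*} [CommRing K] {n : ℕ} (c : Fin (n + 1) → K)
    (M : Fin (n + 1) → Fin n → K) :
    (Matrix.of fun i => (Fin.cons (c i) (M i) : Fin (n + 1) → K)).det =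
      ∑ i : Fin (n + 1), (-1) ^ (i : ℕ) * c i *
        (Matrix.of fun i' j => M (i.succAbove i') j).det := by
  rw [det_succ_column_zero]
  rfl

theorem det_cons_mul {K : Type*} [CommRing K] {n : ℕ} (x : K) (c : Fin (n + 1) → K)
    (M : Fin (n + 1) → Fin n → K) :
    (Matrix.of fun i => (Fin.cons (x * c i) (M i) : Fin (n + 1) → K)).det =
      x * (Matrix.of fun i => (Fin.cons (c i) (M i) : Fin (n + 1) → K)).det := by
  rw [det_cons, det_cons, Finset.mul_sum]
  exact Finset.sum_congr rfl fun i _ => by ring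

theorem det_cons_col_eq_zero {K : Type*} [CommRing K] {n : ℕ} (x : K)
    (M : Fin (n + 1) → Fin n → K) (j : Fin n) :
    (Matrix.of fun i => (Fin.cons (x * M i j) (M i) : Fin (n + 1) → K)).det = 0 := by
  rw [det_cons_mul, det_zero_of_column_eq (i := 0) (j := j.succ) (Fin.succ_ne_zero j).symm
    fun i => by simp, mul_zero]

theorem det_cons_single {K : Type*} [CommRing K] {n : ℕ} (c : Fin (n + 1) → K)
    (M : Fin (n + 1) → Fin n → K) (hc : ∀ i : Fin n, c i.succ = 0) :
    (Matrix.of fun i => (Fin.cons (c i) (M i) : Fin (n + 1) → K)).det =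
      c 0 * (Matrix.of fun i j => M (Fin.succ i) j).det := by
  rw [det_cons, Fin.sum_univ_succ]
  simp [hc]

theorem exists_polynomial_det_cons {K : Type*} [Field K] {n d : ℕ}
    (c : Fin (n + 1) → Polynomial K) (hc : ∀ i, (c i).natDegree ≤ d)
    (M : Fin (n + 1) → Fin n → K) :
    ∃ P : Polynomial K, P.natDegree ≤ d ∧ ∀ x, P.eval x =
      (Matrix.of fun i => (Fin.cons ((c i).eval x) (M i) : Fin (n + 1) → K)).det := by
  refine ⟨∑ i : Fin (n + 1), c i * Polynomial.C ((-1) ^ (i : ℕ) *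
    (Matrix.of fun i' j => M (i.succAbove i') j).det), ?_, fun x => ?_⟩
  · exact Polynomial.natDegree_sum_le_of_forall_le _ _ fun i _ =>
      (Polynomial.natDegree_mul_C_le _ _).trans (hc i)
  · rw [det_cons, Polynomial.eval_finsetSum]
    refine Finset.sum_congr rfl fun i _ => ?_
    rw [Polynomial.eval_mul, Polynomial.eval_C]
    ring

theorem det_vandermonde_succ {K : Type*} [CommRing K] {n : ℕ} (U : Fin (n + 1) → K) :
    (vandermonde U).det =
      (∏ i : Fin n, (U i.succ - U 0)) * (vandermonde fun i : Fin n => U i.succ).det := by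
  simp only [det_vandermonde, Fin.prod_univ_succ, Fin.prod_Ioi_zero, Fin.prod_Ioi_succ]

/-- Two polynomials with common simple roots `v j` have a product divisible by the square of
`∏ j, (X - v j)`; the quotient is determined by its values at sufficiently many nodes. -/
theorem mul_eq_of_nodes {K ι : Type*} [Field K] [Fintype ι] {n : ℕ} {v : Fin n → K} {w : ι → K}
    (hv : Function.Injective v) (hw : Function.Injective w) (hι : 2 * n + 1 < Fintype.card ι)
    (hvw : ∀ i j, w i ≠ v j) {F P Q : Polynomial K} (hF : F.natDegree ≤ 2 * n + 1)
    (hP : P.natDegree ≤ 2 * n) (hQ : Q.natDegree ≤ 2 * n + 1)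
    (hPv : ∀ j, P.eval (v j) = 0) (hQv : ∀ j, Q.eval (v j) = 0)
    (h : ∀ i, F.eval (w i) * (∏ j, (w i - v j)) ^ 2 = P.eval (w i) * Q.eval (w i)) (x : K) :
    F.eval x * (∏ j, (x - v j)) ^ 2 = P.eval x * Q.eval x := by
  set W : Polynomial K := ∏ j, (Polynomial.X - Polynomial.C (v j)) with hW
  have hWm : W.Monic := Polynomial.monic_prod_of_monic _ _ fun j _ => Polynomial.monic_X_sub_C _
  have hWd : W.natDegree = n := by simp [hW]
  have hWe : ∀ x, W.eval x = ∏ j, (x - v j) := fun x => by simp [hW, Polynomial.eval_prod]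
  have hdvd : ∀ R : Polynomial K, (∀ j, R.eval (v j) = 0) → W ∣ R := fun R hR =>
    Finset.prod_dvd_of_coprime
      (fun i _ j _ hij => Polynomial.isCoprime_X_sub_C_of_isUnit_sub
        (sub_ne_zero.2 (hv.ne hij)).isUnit)
      fun j _ => Polynomial.dvd_iff_isRoot.2 (hR j)
  obtain ⟨P', rfl⟩ := hdvd P hPv
  obtain ⟨Q', rfl⟩ := hdvd Q hQv
  have hdeg : ∀ (R : Polynomial K) (m : ℕ), (W * R).natDegree ≤ m + n → R.natDegree ≤ m := by
    intro R m hR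
    by_cases h0 : R = 0
    · simp [h0]
    · rw [hWm.natDegree_mul' h0, hWd] at hR
      omega
  have hP' : P'.natDegree ≤ n := hdeg P' n (by omega)
  have hQ' : Q'.natDegree ≤ n + 1 := hdeg Q' (n + 1) (by omega)
  have h0 : F - P' * Q' = 0 := by
    refine Polynomial.eq_zero_of_natDegree_lt_card_of_eval_eq_zero _ hw (fun i => ?_)
      (lt_of_le_of_lt ?_ hι)
    · have hne : W.eval (w i) ≠ 0 := by
        rw [hWe]
        exact Finset.prod_ne_zero_iff.2 fun j _ => sub_ne_zero.2 (hvw i j)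
      have := h i
      rw [← hWe, Polynomial.eval_mul, Polynomial.eval_mul] at this
      rw [Polynomial.eval_sub, Polynomial.eval_mul]
      refine mul_left_cancel₀ (pow_ne_zero 2 hne) ?_
      linear_combination this
    · refine (Polynomial.natDegree_sub_le _ _).trans (max_le hF ?_)
      exact (Polynomial.natDegree_mul_le_of_le hP' hQ').trans (by omega)
  rw [← hWe, sub_eq_zero.1 h0, Polynomial.eval_mul, Polynomial.eval_mul, Polynomial.eval_mul]
  ring

/-! ### Inhomogeneous determinantal formula -/

/-- The weight of types 1 and 2 in multiplicative parameters; interchanging `p` and `q` gives the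
weight of types 3 and 4. -/
def weightA {K : Type*} [CommRing K] (p q u y : K) : K := p * u - q * y

/-- The product over all rows except `i` of the two weights in a column with parameter `y`. -/
def otherRows {K : Type*} [CommRing K] {n : ℕ} (p q : K) (U : Fin n → K) (y : K) (i : Fin n) : K :=
  ∏ k, if k = i then 1 else weightA p q (U k) y * weightA q p (U k) y

/-- The determinant of the entries `1 / (a b)`, where the denominators of the first column, with
parameter `y`, are cleared. -/
def clearedDetDW {K : Type*} [Field K] {n : ℕ} (p q : K) (U : Fin (n + 1) → K) (V : Fin n → K)
    (y : K) : K :=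
  (Matrix.of fun i => (Fin.cons (otherRows p q U y i)
    (fun j => 1 / (weightA p q (U i) (V j) * weightA q p (U i) (V j))) : Fin (n + 1) → K)).det

/-- The determinant of the entries `1 / a + 1 / b`, where the denominators of the first column, with
parameter `y`, are cleared. -/
def clearedDetHT {K : Type*} [Field K] {n : ℕ} (p q : K) (U : Fin (n + 1) → K) (V : Fin n → K)
    (y : K) : K :=
  (Matrix.of fun i => (Fin.cons
    (otherRows p q U y i * (weightA p q (U i) y + weightA q p (U i) y))
    (fun j => 1 / weightA p q (U i) (V j) + 1 / weightA q p (U i) (V j)) : Fin (n + 1) → K)).det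

/-- The determinantal formula for the inhomogeneous partition function. -/
def DetFormula {K : Type*} [Field K] {n : ℕ} (p q : K) (U V : Fin n → K) : Prop :=
  inhomogeneousZ p q U V * ((vandermonde U).det ^ 2 * (vandermonde V).det ^ 2) =
    (∏ i, ∏ j, weightA p q (U i) (V j) * weightA q p (U i) (V j)) ^ 2 *
    ((Matrix.of fun i j => 1 / (weightA p q (U i) (V j) * weightA q p (U i) (V j))).det *
    (Matrix.of fun i j => 1 / weightA p q (U i) (V j) + 1 / weightA q p (U i) (V j)).det)

/-- The determinantal formula with the denominators in the first column cleared, so that both sides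
are polynomial in the parameter `y` of that column. -/
def ClearedFormula {K : Type*} [Field K] {n : ℕ} (p q : K) (U : Fin (n + 1) → K) (V : Fin n → K)
    (y : K) : Prop :=
  inhomogeneousZ p q U (Fin.cons y V) * ((vandermonde U).det ^ 2 * (vandermonde V).det ^ 2) *
    (∏ j, (y - V j)) ^ 2 =
    clearedDetDW p q U V y * (clearedDetHT p q U V y *
      (∏ i, ∏ j, weightA p q (U i) (V j) * weightA q p (U i) (V j)) ^ 2)

section

variable {K : Type*} [Field K] {n : ℕ} {p q : K}

theorem otherRows_swap (U : Fin n → K) (y : K) : otherRows q p U y = otherRows p q U y := by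
  funext i
  simp only [otherRows, mul_comm]

theorem otherRows_comp_perm (U : Fin n → K) (y : K) (σ : Equiv.Perm (Fin n)) (i : Fin n) :
    otherRows p q (U ∘ σ) y i = otherRows p q U y (σ i) := by
  unfold otherRows
  rw [← Equiv.prod_comp σ fun k => if k = σ i then 1 else _]
  simp [σ.injective.eq_iff]

/-- Clearing denominators multiplies the first column by a common factor. -/
theorem otherRows_mul (U : Fin n → K) (y : K) (i : Fin n) :
    otherRows p q U y i * (weightA p q (U i) y * weightA q p (U i) y) =
      ∏ k, weightA p q (U k) y * weightA q p (U k) y := by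
  unfold otherRows
  rw [← Finset.mul_prod_erase _ _ (Finset.mem_univ i),
    ← Finset.mul_prod_erase _ (fun k => weightA p q (U k) y * _) (Finset.mem_univ i),
    Finset.prod_congr rfl fun k hk => if_neg (Finset.ne_of_mem_erase hk)]
  simp [mul_comm]

theorem DetFormula.swap {U V : Fin n → K} (h : DetFormula p q U V) : DetFormula q p U V := by
  unfold DetFormula at h ⊢
  rw [inhomogeneousZ_swap, h]
  simp only [mul_comm (weightA q p _ _), add_comm (1 / weightA q p _ _)]

theorem ClearedFormula.swap {U : Fin (n + 1) → K} {V : Fin n → K} {y : K}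
    (h : ClearedFormula q p U V y) : ClearedFormula p q U V y := by
  unfold ClearedFormula clearedDetDW clearedDetHT at h ⊢
  rw [inhomogeneousZ_swap, otherRows_swap] at h
  rw [h]
  simp only [mul_comm (weightA q p _ _), add_comm (1 / weightA q p _ _),
    add_comm (weightA q p _ _)]

theorem det_rows_comp_perm {M : Matrix (Fin n) (Fin n) K} (σ : Equiv.Perm (Fin n)) :
    (Matrix.of fun i => M (σ i)).det = (Equiv.Perm.sign σ : ℤ) * M.det :=
  Matrix.det_permute σ M

theorem sign_sq (σ : Equiv.Perm (Fin n)) : (((Equiv.Perm.sign σ : ℤˣ) : ℤ) : K) ^ 2 = 1 := by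
  rcases Int.units_eq_one_or (Equiv.Perm.sign σ) with h | h <;> simp [h]

/-- Both sides of the formula are symmetric in the row parameters. -/
theorem ClearedFormula.of_comp_perm (h : p * q = 1) {U : Fin (n + 1) → K} {V : Fin n → K} {y : K}
    (hU : ∀ i j, q ^ 2 * U i - p ^ 2 * U j ≠ 0) (σ : Equiv.Perm (Fin (n + 1)))
    (hf : ClearedFormula p q (U ∘ σ) V y) : ClearedFormula p q U V y := by
  unfold ClearedFormula at hf ⊢
  have e1 : clearedDetDW p q (U ∘ σ) V y = (Equiv.Perm.sign σ : ℤ) * clearedDetDW p q U V y := by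
    unfold clearedDetDW
    rw [← det_rows_comp_perm]
    simp only [otherRows_comp_perm]
    rfl
  have e2 : clearedDetHT p q (U ∘ σ) V y = (Equiv.Perm.sign σ : ℤ) * clearedDetHT p q U V y := by
    unfold clearedDetHT
    rw [← det_rows_comp_perm]
    simp only [otherRows_comp_perm]
    rfl
  have e3 : (vandermonde (U ∘ σ)).det = (Equiv.Perm.sign σ : ℤ) * (vandermonde U).det := by
    rw [← det_rows_comp_perm]
    rfl
  have e4 : (∏ i, ∏ j, weightA p q ((U ∘ σ) i) (V j) * weightA q p ((U ∘ σ) i) (V j)) =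
      ∏ i, ∏ j, weightA p q (U i) (V j) * weightA q p (U i) (V j) :=
    Equiv.prod_comp σ fun i => ∏ j, weightA p q (U i) (V j) * weightA q p (U i) (V j)
  rw [inhomogeneousZ_comp_perm h _ _ hU, e1, e2, e3, e4, mul_pow, sign_sq, one_mul] at hf
  rw [hf]
  linear_combination (clearedDetDW p q U V y * (clearedDetHT p q U V y *
      (∏ i, ∏ j, weightA p q (U i) (V j) * weightA q p (U i) (V j)) ^ 2)) * sign_sq (K := K) σ

/-- At a zero of the weight `a` of the corner vertex, both sides of the formula reduce to the next
smaller lattice. -/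
theorem ClearedFormula.of_corner (h : p * q = 1) {U : Fin (n + 1) → K} {V : Fin n → K} {y : K}
    (hy : weightA p q (U 0) y = 0) (ih : DetFormula p q (fun i : Fin n => U i.succ) V) :
    ClearedFormula p q U V y := by
  have hother : ∀ i : Fin n, otherRows p q U y i.succ = 0 := fun i =>
    Finset.prod_eq_zero (Finset.mem_univ 0) (by simp [hy, (Fin.succ_ne_zero i).symm])
  have hother0 : otherRows p q U y 0 =
      ∏ i : Fin n, weightA p q (U i.succ) y * weightA q p (U i.succ) y := by
    simp [otherRows, Fin.prod_univ_succ, Fin.succ_ne_zero]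
  have hZ : inhomogeneousZ p q U (Fin.cons y V) = weightA q p (U 0) y *
      (∏ j, weightA q p (U 0) (V j) ^ 2) * (∏ i : Fin n, weightA q p (U i.succ) y ^ 2) *
      inhomogeneousZ p q (fun i : Fin n => U i.succ) V :=
    inhomogeneousZ_frozen p q U (Fin.cons y V) hy
  -- The two families of factors below agree up to powers of `p` and `q`, which cancel.
  have hcol : ∏ i : Fin n, weightA p q (U i.succ) y = p ^ n * ∏ i : Fin n, (U i.succ - U 0) := by
    rw [← Fin.prod_const, ← Finset.prod_mul_distrib]
    refine Finset.prod_congr rfl fun i _ => ?_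
    unfold weightA at hy ⊢
    linear_combination hy
  have hrow : ∏ j, weightA p q (U 0) (V j) = q ^ n * ∏ j, (y - V j) := by
    rw [← Fin.prod_const, ← Finset.prod_mul_distrib]
    refine Finset.prod_congr rfl fun i _ => ?_
    unfold weightA at hy ⊢
    linear_combination hy
  have hpq : p ^ n * q ^ n = 1 := by rw [← mul_pow, h, one_pow]
  unfold DetFormula at ih
  unfold ClearedFormula clearedDetDW clearedDetHT
  rw [det_cons_single _ _ hother, det_cons_single _ _ fun i => by rw [hother, zero_mul], hZ,
    det_vandermonde_succ, hother0, hy, zero_add, Fin.prod_univ_succ]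
  simp only [Finset.prod_mul_distrib, Finset.prod_pow] at ih ⊢
  rw [hcol, hrow]
  set D1 := (Matrix.of fun (i : Fin n) j =>
    1 / (weightA p q (U i.succ) (V j) * weightA q p (U i.succ) (V j))).det
  set D2 := (Matrix.of fun (i : Fin n) j =>
    1 / weightA p q (U i.succ) (V j) + 1 / weightA q p (U i.succ) (V j)).det
  set G := weightA q p (U 0) y * (∏ j, weightA q p (U 0) (V j)) ^ 2 *
    (∏ i : Fin n, weightA q p (U i.succ) y) ^ 2 * (∏ i : Fin n, (U i.succ - U 0)) ^ 2 *
    (∏ j, (y - V j)) ^ 2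
  set W := (∏ i : Fin n, ∏ j, weightA p q (U i.succ) (V j)) *
    ∏ i : Fin n, ∏ j, weightA q p (U i.succ) (V j)
  linear_combination G * ih - G * D1 * D2 * W ^ 2 * (p ^ n * q ^ n + 1) * hpq

theorem clearedDetDW_eq_zero {U : Fin (n + 1) → K} {V : Fin n → K}
    (hA : ∀ i j, weightA p q (U i) (V j) ≠ 0) (hB : ∀ i j, weightA q p (U i) (V j) ≠ 0)
    (j : Fin n) : clearedDetDW p q U V (V j) = 0 := by
  rw [← det_cons_col_eq_zero (∏ k, weightA p q (U k) (V j) * weightA q p (U k) (V j))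
    (fun i j => 1 / (weightA p q (U i) (V j) * weightA q p (U i) (V j))) j]
  unfold clearedDetDW
  congr! 4 with i
  rw [← otherRows_mul U (V j) i]
  field_simp [hA i j, hB i j]

theorem clearedDetHT_eq_zero {U : Fin (n + 1) → K} {V : Fin n → K}
    (hA : ∀ i j, weightA p q (U i) (V j) ≠ 0) (hB : ∀ i j, weightA q p (U i) (V j) ≠ 0)
    (j : Fin n) : clearedDetHT p q U V (V j) = 0 := by
  rw [← det_cons_col_eq_zero (∏ k, weightA p q (U k) (V j) * weightA q p (U k) (V j))
    (fun i j => 1 / weightA p q (U i) (V j) + 1 / weightA q p (U i) (V j)) j]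
  unfold clearedDetHT
  congr! 4 with i
  rw [← otherRows_mul U (V j) i]
  have := hA i j
  have := hB i j
  field_simp
  ring

/-- The cleared formula for the parameter `V 0` is the full formula. -/
theorem ClearedFormula.detFormula {U V : Fin (n + 1) → K}
    (hA : ∀ i j, weightA p q (U i) (V j) ≠ 0) (hB : ∀ i j, weightA q p (U i) (V j) ≠ 0)
    (h : ClearedFormula p q U (fun j => V j.succ) (V 0)) : DetFormula p q U V := by
  unfold ClearedFormula at h
  have hV : (Fin.cons (V 0) fun j => V j.succ : Fin (n + 1) → K) = V := Fin.cons_self_tail V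
  have e1 : clearedDetDW p q U (fun j => V j.succ) (V 0) =
      (∏ k, weightA p q (U k) (V 0) * weightA q p (U k) (V 0)) * (Matrix.of fun i j =>
        1 / (weightA p q (U i) (V j) * weightA q p (U i) (V j))).det := by
    unfold clearedDetDW
    rw [show (Matrix.of fun i j => 1 / (weightA p q (U i) (V j) * weightA q p (U i) (V j))) =
      Matrix.of fun i => (Fin.cons (1 / (weightA p q (U i) (V 0) * weightA q p (U i) (V 0)))
        (fun j : Fin n => 1 / (weightA p q (U i) (V j.succ) * weightA q p (U i) (V j.succ))) :
          Fin (n + 1) → K) by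
        ext i j
        refine Fin.cases ?_ (fun j => ?_) j <;> simp, ← det_cons_mul]
    congr! 4 with i
    rw [← otherRows_mul U (V 0) i]
    field_simp [hA i 0, hB i 0]
  have e2 : clearedDetHT p q U (fun j => V j.succ) (V 0) =
      (∏ k, weightA p q (U k) (V 0) * weightA q p (U k) (V 0)) * (Matrix.of fun i j =>
        1 / weightA p q (U i) (V j) + 1 / weightA q p (U i) (V j)).det := by
    unfold clearedDetHT
    rw [show (Matrix.of fun i j => 1 / weightA p q (U i) (V j) + 1 / weightA q p (U i) (V j)) =
      Matrix.of fun i => (Fin.cons (1 / weightA p q (U i) (V 0) + 1 / weightA q p (U i) (V 0))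
        (fun j : Fin n => 1 / weightA p q (U i) (V j.succ) + 1 / weightA q p (U i) (V j.succ)) :
          Fin (n + 1) → K) by
        ext i j
        refine Fin.cases ?_ (fun j => ?_) j <;> simp, ← det_cons_mul]
    congr! 4 with i
    rw [← otherRows_mul U (V 0) i]
    have := hA i 0
    have := hB i 0
    field_simp
    ring
  have e3 : (∏ i, ∏ j, weightA p q (U i) (V j) * weightA q p (U i) (V j)) =
      (∏ i, weightA p q (U i) (V 0) * weightA q p (U i) (V 0)) *
      ∏ i, ∏ j : Fin n, weightA p q (U i) (V j.succ) * weightA q p (U i) (V j.succ) := by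
    rw [← Finset.prod_mul_distrib]
    exact Finset.prod_congr rfl fun i _ => Fin.prod_univ_succ _
  have e4 : (∏ j : Fin n, (V j.succ - V 0)) ^ 2 = (∏ j : Fin n, (V 0 - V j.succ)) ^ 2 := by
    rw [← Finset.prod_pow, ← Finset.prod_pow]
    exact Finset.prod_congr rfl fun j _ => by ring
  rw [hV, e1, e2] at h
  unfold DetFormula
  rw [det_vandermonde_succ V, mul_pow, e4, e3]
  linear_combination h

theorem natDegree_weightA (p q u : K) :
    (Polynomial.C (-q) * Polynomial.X + Polynomial.C (p * u)).natDegree ≤ 1 :=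
  Polynomial.natDegree_linear_le

theorem exists_polynomial_otherRows (U : Fin (n + 1) → K) (i : Fin (n + 1)) :
    ∃ P : Polynomial K, P.natDegree ≤ 2 * n ∧ ∀ y, P.eval y = otherRows p q U y i := by
  refine ⟨∏ k, if k = i then 1 else
    (Polynomial.C (-q) * Polynomial.X + Polynomial.C (p * U k)) *
    (Polynomial.C (-p) * Polynomial.X + Polynomial.C (q * U k)), ?_, fun y => ?_⟩
  · rw [← Finset.mul_prod_erase _ _ (Finset.mem_univ i), if_pos rfl, one_mul]
    refine (Polynomial.natDegree_prod_le _ _).trans ?_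
    refine (Finset.sum_le_card_nsmul _ _ 2 fun k hk => ?_).trans (le_of_eq ?_)
    · rw [if_neg (Finset.ne_of_mem_erase hk)]
      exact Polynomial.natDegree_mul_le_of_le (natDegree_weightA p q _) (natDegree_weightA q p _)
    · simp [mul_comm]
  · rw [Polynomial.eval_prod]
    refine Finset.prod_congr rfl fun k _ => ?_
    split_ifs <;> simp [weightA]
    ring

/-- The determinantal formula for generic parameters. -/
theorem detFormula (h : p * q = 1) : ∀ {n : ℕ} {U V : Fin n → K} (_ : Function.Injective U)
    (_ : Function.Injective V) (_ : ∀ i j, q ^ 2 * U i - p ^ 2 * U j ≠ 0)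
    (_ : ∀ i j, weightA p q (U i) (V j) ≠ 0) (_ : ∀ i j, weightA q p (U i) (V j) ≠ 0),
    DetFormula p q U V
  | 0, U, V, _, _, _, _, _ => by
    simp [DetFormula, inhomogeneousZ, halfTurnSum, one_apply, eq_iff_true_of_subsingleton]
  | n + 1, U, V, hU, hV, hq, hA, hB => by
    have hp0 : p ≠ 0 := left_ne_zero_of_mul_eq_one h
    have hq0 : q ≠ 0 := right_ne_zero_of_mul_eq_one h
    have hq' : ∀ i j, p ^ 2 * U i - q ^ 2 * U j ≠ 0 := fun i j h =>
      hq j i (by linear_combination -h)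
    refine ClearedFormula.detFormula hA hB ?_
    -- The nodes are the zeros of the weights `a` and `b` in the first column.
    let w : Fin (n + 1) ⊕ Fin (n + 1) → K := Sum.elim (fun i => p ^ 2 * U i) fun i => q ^ 2 * U i
    have hwA : ∀ i, weightA p q (U i) (p ^ 2 * U i) = 0 := fun i => by
      unfold weightA
      linear_combination -p * U i * h
    have hwB : ∀ i, weightA q p (U i) (q ^ 2 * U i) = 0 := fun i => by
      unfold weightA
      linear_combination -q * U i * h
    have hw : Function.Injective w := by
      refine Function.Injective.sumElim
        (fun i j hij => hU (mul_left_cancel₀ (pow_ne_zero 2 hp0) hij))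
        (fun i j hij => hU (mul_left_cancel₀ (pow_ne_zero 2 hq0) hij)) fun i j hij => ?_
      exact hq j i (sub_eq_zero.2 hij.symm)
    have ih : ∀ σ : Equiv.Perm (Fin (n + 1)),
        DetFormula p q (fun i : Fin n => (U ∘ σ) i.succ) fun j => V j.succ := fun σ =>
      detFormula h ((hU.comp σ.injective).comp (Fin.succ_injective n))
        (hV.comp (Fin.succ_injective n)) (fun _ _ => hq _ _) (fun _ _ => hA _ _)
        fun _ _ => hB _ _
    have hnode : ∀ i, ClearedFormula p q U (fun j => V j.succ) (w i) := by
      rintro (i | i)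
      · refine ClearedFormula.of_comp_perm h hq (Equiv.swap 0 i) ?_
        refine ClearedFormula.of_corner h ?_ (ih _)
        simpa [w] using hwA i
      · refine ClearedFormula.swap ?_
        refine ClearedFormula.of_comp_perm (by rw [mul_comm, h]) hq' (Equiv.swap 0 i) ?_
        refine ClearedFormula.of_corner (by rw [mul_comm, h]) ?_ (ih _).swap
        simpa [w] using hwB i
    have hvw : ∀ i (j : Fin n), w i ≠ V j.succ := by
      rintro (i | i) j hij
      · exact hA i j.succ (by rw [← hij]; exact hwA i)
      · exact hB i j.succ (by rw [← hij]; exact hwB i)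
    obtain ⟨F, hF, hFe⟩ := exists_polynomial_inhomogeneousZ p q U fun j => V j.succ
    choose c hc hce using fun i => exists_polynomial_otherRows (p := p) (q := q) U i
    obtain ⟨P, hP, hPe⟩ := exists_polynomial_det_cons c hc fun i (j : Fin n) =>
      1 / (weightA p q (U i) (V j.succ) * weightA q p (U i) (V j.succ))
    obtain ⟨Q, hQ, hQe⟩ := exists_polynomial_det_cons (fun i => c i *
      ((Polynomial.C (-q) * Polynomial.X + Polynomial.C (p * U i)) +
      (Polynomial.C (-p) * Polynomial.X + Polynomial.C (q * U i))))
      (d := 2 * n + 1) (fun i => Polynomial.natDegree_mul_le_of_le (hc i)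
        (Polynomial.natDegree_add_le_of_degree_le (natDegree_weightA p q _)
          (natDegree_weightA q p _))) fun i (j : Fin n) =>
      1 / weightA p q (U i) (V j.succ) + 1 / weightA q p (U i) (V j.succ)
    have hPe' : ∀ y, P.eval y = clearedDetDW p q U (fun j => V j.succ) y := fun y => by
      rw [hPe]
      simp only [hce]
      rfl
    have hQe' : ∀ y, Q.eval y = clearedDetHT p q U (fun j => V j.succ) y := fun y => by
      rw [hQe, clearedDetHT]
      congr! 4 with i
      rw [Polynomial.eval_mul, hce]
      simp only [weightA, Polynomial.eval_add, Polynomial.eval_mul, Polynomial.eval_C,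
        Polynomial.eval_X]
      ring
    have := mul_eq_of_nodes (v := fun j : Fin n => V j.succ) (w := w)
      (F := F * Polynomial.C ((vandermonde U).det ^ 2 *
        (vandermonde fun j : Fin n => V j.succ).det ^ 2)) (P := P)
      (Q := Q * Polynomial.C ((∏ i, ∏ j : Fin n,
        weightA p q (U i) (V j.succ) * weightA q p (U i) (V j.succ)) ^ 2))
      (hV.comp (Fin.succ_injective n)) hw (by simp; omega) hvw
      ((Polynomial.natDegree_mul_C_le _ _).trans hF) hP
      ((Polynomial.natDegree_mul_C_le _ _).trans hQ)
      (fun j => by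
        rw [hPe']
        exact clearedDetDW_eq_zero (fun i j => hA i j.succ) (fun i j => hB i j.succ) j)
      (fun j => by
        rw [Polynomial.eval_mul, hQe', clearedDetHT_eq_zero (fun i j => hA i j.succ)
          (fun i j => hB i j.succ) j, zero_mul])
      (fun i => by
        simpa only [Polynomial.eval_mul, Polynomial.eval_C, hFe, hPe', hQe',
          ClearedFormula] using hnode i)
      (V 0)
    simpa only [Polynomial.eval_mul, Polynomial.eval_C, hFe, hPe', hQe',
      ClearedFormula] using this

end

/-! ### Forward differences and Hankel determinants -/

/-- Difference quotients of order `m` converge to the `m`-th derivative. -/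
theorem tendsto_fwdDiff_div_pow {f : ℝ → ℝ} {s : Set ℝ} {t : ℝ} {m : ℕ} (hs : IsOpen s)
    (hc : Convex ℝ s) (ht : t ∈ s) (hf : ContDiffOn ℝ m f s) :
    Tendsto (fun ε : ℝ => (fwdDiff ε)^[m] f t / ε ^ m) (𝓝[≠] 0) (𝓝 (iteratedDeriv m f t)) := by
  set r : ℝ → ℝ := fun x => f x - taylorWithinEval f m s t x with hr
  have hro : r =o[𝓝 t] fun x => (x - t) ^ m := by
    simpa [hs.nhdsWithin_eq ht] using taylor_isLittleO hc ht hf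
  -- The remainder at `t + k ε` is negligible.
  have hrk : ∀ k : ℕ, Tendsto (fun ε : ℝ => r (t + k • ε) / ε ^ m) (𝓝[≠] 0) (𝓝 0) := by
    intro k
    have h1 : Tendsto (fun ε : ℝ => t + k • ε) (𝓝 0) (𝓝 t) := by
      have : Continuous fun ε : ℝ => t + k • ε := by fun_prop
      simpa using this.tendsto 0
    have h2 : (fun ε : ℝ => r (t + k • ε)) =o[𝓝 0] fun ε : ℝ => ε ^ m := by
      refine (hro.comp_tendsto h1).trans_isBigO ?_
      have : ((fun x => (x - t) ^ m) ∘ fun ε : ℝ => t + k • ε) =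
          fun ε : ℝ => (k : ℝ) ^ m * ε ^ m := by
        funext ε
        simp [mul_pow]
      rw [this]
      exact (isBigO_refl _ _).const_mul_left _
    exact (h2.mono nhdsWithin_le_nhds).tendsto_div_nhds_zero
  -- The Taylor polynomial contributes only through its leading coefficient.
  have hpow : ∀ j ≤ m, ∑ k ∈ Finset.range (m + 1), ((-1 : ℤ) ^ (m - k) * m.choose k) •
      (k : ℝ) ^ j = if j = m then (m.factorial : ℝ) else 0 := by
    intro j hj
    have h := fwdDiff_iter_eq_sum_shift (1 : ℝ) (fun x : ℝ => x ^ j) m 0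
    simp only [zero_add, nsmul_eq_mul, mul_one] at h
    rw [← h]
    split_ifs with hjm
    · subst hjm
      rw [fwdDiff_iter_eq_factorial]
      rfl
    · rw [fwdDiff_iter_pow_eq_zero_of_lt (lt_of_le_of_ne hj hjm)]
      rfl
  have hT : ∀ ε : ℝ, ∑ k ∈ Finset.range (m + 1), ((-1 : ℤ) ^ (m - k) * m.choose k) •
      taylorWithinEval f m s t (t + k • ε) = ε ^ m * iteratedDeriv m f t := by
    intro ε
    have e : ∀ k : ℕ, ((-1 : ℤ) ^ (m - k) * m.choose k) •
        taylorWithinEval f m s t (t + k • ε) = ∑ j ∈ Finset.range (m + 1),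
          ((j.factorial : ℝ)⁻¹ * ε ^ j * iteratedDerivWithin j f s t) *
            (((-1 : ℤ) ^ (m - k) * m.choose k) • (k : ℝ) ^ j) := by
      intro k
      rw [taylor_within_apply, Finset.smul_sum]
      refine Finset.sum_congr rfl fun j _ => ?_
      simp only [zsmul_eq_mul, nsmul_eq_mul, smul_eq_mul, add_sub_cancel_left, mul_pow]
      ring
    simp only [e]
    rw [Finset.sum_comm]
    simp only [← Finset.mul_sum]
    rw [Finset.sum_eq_single_of_mem m (by simp)]
    · rw [hpow m le_rfl, if_pos rfl, iteratedDerivWithin_of_isOpen hs ht]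
      field_simp [Nat.factorial_ne_zero]
    · intro j hj hjm
      rw [hpow j (Nat.lt_succ_iff.1 (Finset.mem_range.1 hj)), if_neg hjm, mul_zero]
  have hlim : Tendsto (fun ε : ℝ => iteratedDeriv m f t + ∑ k ∈ Finset.range (m + 1),
      (((-1 : ℤ) ^ (m - k) * m.choose k : ℤ) : ℝ) * (r (t + k • ε) / ε ^ m)) (𝓝[≠] 0)
      (𝓝 (iteratedDeriv m f t)) := by
    have : Tendsto (fun ε : ℝ => ∑ k ∈ Finset.range (m + 1),
      (((-1 : ℤ) ^ (m - k) * m.choose k : ℤ) : ℝ) * (r (t + k • ε) / ε ^ m)) (𝓝[≠] 0)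
      (𝓝 (∑ k ∈ Finset.range (m + 1), (((-1 : ℤ) ^ (m - k) * m.choose k : ℤ) : ℝ) * 0)) :=
      tendsto_finsetSum _ fun k _ => (hrk k).const_mul _
    simpa using this.const_add (iteratedDeriv m f t)
  refine hlim.congr' ?_
  filter_upwards [self_mem_nhdsWithin] with ε hε
  have hε : ε ≠ 0 := hε
  rw [fwdDiff_iter_eq_sum_shift, eq_div_iff (pow_ne_zero _ hε), add_mul, mul_comm _ (ε ^ m),
    ← hT ε, Finset.sum_mul, ← Finset.sum_add_distrib]
  refine Finset.sum_congr rfl fun k _ => ?_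
  rw [mul_assoc, div_mul_cancel₀ _ (pow_ne_zero _ hε)]
  simp only [hr, zsmul_eq_mul]
  ring

/-- Unimodular row and column operations turn a Hankel matrix of values into one of forward
differences. -/
theorem det_hankel_eq_det_fwdDiff (n : ℕ) (f : ℝ → ℝ) (t ε : ℝ) :
    (Matrix.of fun i j : Fin n => f (t + ε * ((i : ℝ) + j))).det =
      (Matrix.of fun i j : Fin n => (fwdDiff ε)^[(i : ℕ) + j] f t).det := by
  set P : Matrix (Fin n) (Fin n) ℝ :=
    Matrix.of fun i k => (((-1 : ℤ) ^ ((i : ℕ) - k) * (i : ℕ).choose k : ℤ) : ℝ) with hP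
  have hsum : ∀ (i : Fin n) (g : ℝ → ℝ) (x : ℝ),
      (fwdDiff ε)^[(i : ℕ)] g x = ∑ k, P i k * g (x + ε * (k : ℕ)) := by
    intro i g x
    rw [fwdDiff_iter_eq_sum_shift]
    simp only [hP, of_apply]
    rw [Fin.sum_univ_eq_sum_range fun k => (((-1 : ℤ) ^ ((i : ℕ) - k) * (i : ℕ).choose k : ℤ) : ℝ) *
      g (x + ε * (k : ℕ))]
    have hsub : Finset.range ((i : ℕ) + 1) ⊆ Finset.range n :=
      Finset.range_subset_range.2 i.isLt
    rw [← Finset.sum_subset hsub]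
    · refine Finset.sum_congr rfl fun k _ => ?_
      rw [zsmul_eq_mul, nsmul_eq_mul, mul_comm ε]
    · intro k _ hk
      rw [Nat.choose_eq_zero_of_lt (by simpa using hk)]
      simp
  have hdet : P.det = 1 := by
    rw [det_of_isLowerTriangular P]
    · simp [hP]
    · intro i k hik
      have : (i : ℕ) < k := hik
      simp [hP, Nat.choose_eq_zero_of_lt this]
  have : (Matrix.of fun i j : Fin n => (fwdDiff ε)^[(i : ℕ) + j] f t) =
      P * (Matrix.of fun i j : Fin n => f (t + ε * ((i : ℝ) + j))) * Pᵀ := by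
    ext i j
    rw [of_apply, Function.iterate_add_apply, hsum]
    simp only [hsum, mul_apply, transpose_apply, of_apply, Finset.mul_sum, Finset.sum_mul]
    rw [Finset.sum_comm]
    refine Finset.sum_congr rfl fun k _ => Finset.sum_congr rfl fun l _ => ?_
    rw [show t + ε * (l : ℕ) + ε * (k : ℕ) = t + ε * ((l : ℝ) + k) by ring]
    ring
  rw [this, det_mul, det_mul, det_transpose, hdet]
  ring

theorem tendsto_det_hankel {n : ℕ} {f : ℝ → ℝ} {s : Set ℝ} {t : ℝ} (hs : IsOpen s)
    (hc : Convex ℝ s) (ht : t ∈ s) (hf : ∀ m : ℕ, ContDiffOn ℝ m f s) :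
    Tendsto (fun ε : ℝ => (Matrix.of fun i j : Fin n => f (t + ε * ((i : ℝ) + j))).det /
      (∏ i : Fin n, ε ^ (i : ℕ)) ^ 2) (𝓝[≠] 0) (𝓝 (hankelDet n f t)) := by
  have h1 : Tendsto (fun ε : ℝ => (Matrix.of fun i j : Fin n =>
      (fwdDiff ε)^[(i : ℕ) + j] f t / ε ^ ((i : ℕ) + j)).det) (𝓝[≠] 0) (𝓝 (hankelDet n f t)) := by
    unfold hankelDet
    simp only [det_apply, of_apply]
    refine tendsto_finsetSum _ fun σ _ => Tendsto.const_smul ?_ _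
    exact tendsto_finsetProd _ fun i _ => tendsto_fwdDiff_div_pow hs hc ht (hf _)
  refine h1.congr' ?_
  filter_upwards [self_mem_nhdsWithin] with ε hε
  have hε : ε ≠ 0 := hε
  have hE : ∏ i : Fin n, ε ^ (i : ℕ) ≠ 0 := Finset.prod_ne_zero_iff.2 fun i _ => pow_ne_zero _ hε
  rw [det_hankel_eq_det_fwdDiff, eq_div_iff (pow_ne_zero 2 hE), mul_comm, sq, mul_assoc,
    ← det_mul_column, ← det_mul_row]
  congr 1
  ext i j
  simp only [of_apply]
  have := pow_ne_zero (i : ℕ) hε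
  have := pow_ne_zero (j : ℕ) hε
  rw [pow_add]
  field_simp

theorem prod_Ioi_const {M : Type*} [CommMonoid M] (n : ℕ) (x : M) :
    ∏ i : Fin n, ∏ _j ∈ Finset.Ioi i, x = ∏ i : Fin n, x ^ (i : ℕ) := by
  rw [Finset.prod_comm' (t' := Finset.univ) (s' := fun j => Finset.Iio j) (by simp)]
  simp

theorem prod_pow_sq_mul_pow {M : Type*} [CommMonoid M] (n : ℕ) (x : M) :
    (∏ i : Fin n, x ^ (i : ℕ)) ^ 2 * x ^ n = x ^ (n ^ 2) := by
  rw [Finset.prod_pow_eq_pow_sum, ← pow_mul, ← pow_add,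
    Fin.sum_univ_eq_sum_range (fun i => i) n, Finset.sum_range_id_mul_two]
  congr 1
  cases n with
  | zero => rfl
  | succ n => simp; ring

theorem prod_Ioi_sub_eq_factorial (n : ℕ) :
    ∏ i : Fin n, ∏ j ∈ Finset.Ioi i, ((j : ℂ) - (i : ℂ)) =
      ∏ j ∈ Finset.range n, (j.factorial : ℂ) := by
  cases n with
  | zero => simp
  | succ n =>
    rw [← det_vandermonde (fun i : Fin (n + 1) => ((i : ℕ) : ℂ)),
      det_vandermonde_id_eq_superFactorial, ← Nat.prod_range_succ_factorial]
    push_cast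
    rfl

/-- The Vandermonde determinant of nodes in a geometric progression, as the nodes coalesce; it
vanishes like the `n * (n - 1) / 2`-th power of `ε`. -/
theorem tendsto_det_vandermonde (n : ℕ) (w z : ℂ) :
    Tendsto (fun ε : ℝ => (vandermonde fun i : Fin n => w * Complex.exp (z * ε * i)).det /
      ((∏ i : Fin n, ε ^ (i : ℕ) : ℝ) : ℂ)) (𝓝[≠] 0)
      (𝓝 ((∏ i : Fin n, (w * z) ^ (i : ℕ)) * ∏ j ∈ Finset.range n, (j.factorial : ℂ))) := by
  rw [← prod_Ioi_sub_eq_factorial, ← prod_Ioi_const, ← Finset.prod_mul_distrib]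
  simp only [← Finset.prod_mul_distrib, det_vandermonde, Complex.ofReal_prod, ← prod_Ioi_const,
    ← Finset.prod_div_distrib]
  refine tendsto_finsetProd _ fun i _ => tendsto_finsetProd _ fun j _ => ?_
  have h : ∀ k : ℂ, HasDerivAt (fun ε : ℝ => w * Complex.exp (z * ε * k)) (w * (z * k)) 0 := by
    intro k
    have h1 : HasDerivAt (fun ε : ℝ => z * (ε : ℂ) * k) (z * k) 0 := by
      simpa using ((Complex.ofRealCLM.hasDerivAt (x := (0 : ℝ))).const_mul z).mul_const k
    simpa using h1.cexp.const_mul w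
  have hd := ((h j).sub (h i)).tendsto_slope_zero
  rw [show w * (z * (j : ℂ)) - w * (z * (i : ℂ)) = w * z * ((j : ℂ) - i) by ring] at hd
  refine hd.congr fun ε => ?_
  simp [div_eq_inv_mul, Complex.real_smul]

/-! ### Homogeneous weights -/

/-- The half-turn symmetric partition function with homogeneous weights. -/
def homogeneousZ {K : Type*} [CommRing K] (n : ℕ) (a b c d : K) : K :=
  halfTurnSum (List.replicate n (transfer fun _ : Fin n => vertexOp a b c d))

theorem rowOp_map {K K' : Type*} [CommRing K] [CommRing K'] (f : K →+* K') : ∀ {n : ℕ}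
    (L : Fin n → Bool → Bool → Matrix Bool Bool K) (s s' : Fin n → Bool × Bool),
    rowOp n (fun j t m => (L j t m).map f) s s' = (rowOp n L s s').map f
  | 0, _, _, _ => by simp [rowOp]
  | n + 1, L, s, s' => by
    simp only [rowOp, Matrix.map_mul, rowOp_map f]

theorem homogeneousZ_map {K K' : Type*} [CommRing K] [CommRing K'] (f : K →+* K') (n : ℕ)
    (a b c d : K) : homogeneousZ n (f a) (f b) (f c) (f d) = f (homogeneousZ n a b c d) := by
  have hv : (vertexOp (f a) (f b) (f c) (f d)) = fun t m => (vertexOp a b c d t m).map f := by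
    funext t m
    ext l r
    cases t <;> cases m <;> cases l <;> cases r <;> simp [vertexOp, vertexType]
  have hT : transfer (fun _ : Fin n => vertexOp (f a) (f b) (f c) (f d)) =
      f.mapMatrix (transfer fun _ : Fin n => vertexOp a b c d) := by
    ext s s'
    simp only [transfer, hv, of_apply, rowOp_map, RingHom.mapMatrix_apply, map_apply]
  unfold homogeneousZ halfTurnSum
  rw [hT, map_sum]
  refine Finset.sum_congr rfl fun g _ => ?_
  rw [List.prod_replicate, List.prod_replicate, ← map_pow]
  rfl

/-- Weights of types 5 and 6 may be changed at constant product: along a row, the factors `z`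
telescope. -/
theorem rowOp_gauge {K : Type*} [CommRing K] (w z : K) : ∀ {n : ℕ}
    (L L' : Fin n → Bool → Bool → Matrix Bool Bool K)
    (_ : ∀ j t m l r, L' j t m l r * z ^ r.toNat = w * z ^ l.toNat * L j t m l r)
    (s s' : Fin n → Bool × Bool) (l r : Bool),
    rowOp n L' s s' l r * z ^ r.toNat = w ^ (2 * n) * z ^ l.toNat * rowOp n L s s' l r
  | 0, _, _, _, _, _, l, r => by cases l <;> cases r <;> simp [rowOp]
  | n + 1, L, L', h, s, s', l, r => by
    have ih := rowOp_gauge w z (fun j => L j.succ) (fun j => L' j.succ) (fun j => h j.succ)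
      (fun j => s j.succ) fun j => s' j.succ
    have step : ∀ x y, L' 0 (s 0).1 (s' 0).1 l x *
        rowOp n (fun j => L' j.succ) (fun j => s j.succ) (fun j => s' j.succ) x y *
        L' 0 (s 0).2 (s' 0).2 y r * z ^ r.toNat = w ^ (2 * (n + 1)) * z ^ l.toNat *
        (L 0 (s 0).1 (s' 0).1 l x *
        rowOp n (fun j => L j.succ) (fun j => s j.succ) (fun j => s' j.succ) x y *
        L 0 (s 0).2 (s' 0).2 y r) := by
      intro x y
      rw [mul_assoc, h]
      linear_combination w * L' 0 (s 0).1 (s' 0).1 l x * L 0 (s 0).2 (s' 0).2 y r * ih x y +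
        w ^ (2 * n + 1) * L 0 (s 0).2 (s' 0).2 y r *
        rowOp n (fun j => L j.succ) (fun j => s j.succ) (fun j => s' j.succ) x y *
        h 0 (s 0).1 (s' 0).1 l x
    simp only [rowOp, mul_apply, Finset.sum_mul, Finset.mul_sum, step]

/-- Each row has one vertex of type 5 more than of type 6, and there are `n` rows with `2 * n`
vertices each. -/
theorem homogeneousZ_gauge {K : Type*} [CommRing K] (n : ℕ) (w a b c : K) :
    (w * c) ^ n * homogeneousZ n (w * a) (w * b) 1 ((w * c) ^ 2) =
      w ^ (2 * n ^ 2) * homogeneousZ n a b c c := by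
  have hT : (w * c) • transfer (fun _ : Fin n => vertexOp (w * a) (w * b) 1 ((w * c) ^ 2)) =
      w ^ (2 * n) • transfer fun _ : Fin n => vertexOp a b c c := by
    ext s s'
    have := rowOp_gauge w (w * c) (fun _ : Fin n => vertexOp a b c c)
      (fun _ : Fin n => vertexOp (w * a) (w * b) 1 ((w * c) ^ 2)) ?_ s s' false true
    · simpa [transfer, mul_comm] using this
    · intro j t m l r
      cases t <;> cases m <;> cases l <;> cases r <;> simp [vertexOp, vertexType] <;> ring
  unfold homogeneousZ halfTurnSum
  rw [Finset.mul_sum, Finset.mul_sum]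
  refine Finset.sum_congr rfl fun g _ => ?_
  have h : ((w * c) • transfer (fun _ : Fin n =>
      vertexOp (w * a) (w * b) 1 ((w * c) ^ 2))) ^ n =
      (w ^ (2 * n) • transfer fun _ : Fin n => vertexOp a b c c) ^ n := by rw [hT]
  rw [smul_pow, smul_pow, ← pow_mul, show 2 * n * n = 2 * n ^ 2 by ring] at h
  rw [List.prod_replicate, List.prod_replicate]
  exact congrFun (congrFun h _) _

/-! ### Continuity in the parameters -/

theorem continuous_rowOp {X K : Type*} [TopologicalSpace X] [CommRing K] [TopologicalSpace K]
    [IsTopologicalRing K] : ∀ {n : ℕ} {L : X → Fin n → Bool → Bool → Matrix Bool Bool K}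
    (_ : ∀ j t m, Continuous fun x => L x j t m) (s s' : Fin n → Bool × Bool),
    Continuous fun x => rowOp n (L x) s s'
  | 0, _, _, _, _ => continuous_const
  | n + 1, L, h, s, s' => by
    simp only [rowOp]
    exact ((h 0 _ _).matrix_mul (continuous_rowOp (fun j => h j.succ) _ _)).matrix_mul (h 0 _ _)

theorem continuous_inhomogeneousZ {X K : Type*} [TopologicalSpace X] [CommRing K]
    [TopologicalSpace K] [IsTopologicalRing K] {n : ℕ} (p q : K) {U V : X → Fin n → K}
    (hU : Continuous U) (hV : Continuous V) : Continuous fun x =>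
      inhomogeneousZ p q (U x) (V x) := by
  have hU' := fun i => (continuous_apply i).comp hU
  have hV' := fun i => (continuous_apply i).comp hV
  simp only [Function.comp_def] at hU' hV'
  have hT : ∀ i, Continuous fun x => spectralTransfer p q (V x) (U x i) := by
    intro i
    refine continuous_matrix fun s s' => Continuous.matrix_elem (continuous_rowOp ?_ s s') _ _
    intro j t m
    refine continuous_matrix fun l r => ?_
    have := hU' i
    have := hV' j
    cases t <;> cases m <;> cases l <;> cases r <;> simp [spectralOp, vertexOp, vertexType] <;>
      fun_prop
  unfold inhomogeneousZ halfTurnSum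
  refine continuous_finsetSum _ fun g _ => Continuous.matrix_elem ?_ _ _
  have : ∀ x, (List.ofFn fun i => spectralTransfer p q (V x) (U x i)) =
      (List.finRange n).map fun i => spectralTransfer p q (V x) (U x i) := fun x =>
    List.ofFn_eq_map
  simp only [this]
  exact continuous_list_prod _ fun i _ => hT i

/-! ### Homogeneous limit -/

theorem ofReal_det {n : ℕ} (M : Matrix (Fin n) (Fin n) ℝ) :
    ((M.det : ℝ) : ℂ) = (M.map fun x => (x : ℂ)).det :=
  RingHom.map_det Complex.ofRealHom M

/-- The formula for any weights `a`, `b`, `c` that come from the multiplicative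
parametrization. -/
theorem homogeneousZ_eq {p q κ v μ : ℂ} {a b : ℝ → ℝ} {c t : ℝ} (n : ℕ) (h : p * q = 1)
    (hκ : κ ≠ 0) (hv : v ≠ 0) (hμ : μ ^ 2 = 4 * κ ^ 2 * v)
    (hc : (q ^ 2 - p ^ 2) ^ 2 * v = μ ^ 2 * (c : ℂ) ^ 2) (hc0 : c ≠ 0)
    (ha : ∀ x y : ℝ, p * Complex.exp (κ * x) ^ 2 - q * (v * Complex.exp (-κ * y) ^ 2) =
      μ * (Complex.exp (κ * x) * Complex.exp (-κ * y)) * a (x + y))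
    (hb : ∀ x y : ℝ, q * Complex.exp (κ * x) ^ 2 - p * (v * Complex.exp (-κ * y) ^ 2) =
      μ * (Complex.exp (κ * x) * Complex.exp (-κ * y)) * b (x + y))
    (has : ∀ m : ℕ, ContDiff ℝ m a) (hbs : ∀ m : ℕ, ContDiff ℝ m b)
    (hat : a t ≠ 0) (hbt : b t ≠ 0) :
    homogeneousZ n (a t) (b t) c c * ∏ j ∈ Finset.range n, (j.factorial : ℝ) ^ 4 =
      (a t * b t) ^ (2 * n ^ 2) * hankelDet n (fun s => c / (a s * b s)) t *
        hankelDet n (fun s => 1 / a s + 1 / b s) t := by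
  have hμ0 : μ ≠ 0 := fun h0 => by
    rw [h0, zero_pow two_ne_zero] at hμ
    exact mul_ne_zero (mul_ne_zero (by norm_num : (4 : ℂ) ≠ 0) (pow_ne_zero 2 hκ)) hv hμ.symm
  have hcC : (c : ℂ) ≠ 0 := Complex.ofReal_ne_zero.2 hc0
  -- The row parameters are `t + ε i`, the column parameters `-ε j`.
  set g : ℝ → Fin n → ℂ := fun ε i => Complex.exp (κ * (t + ε * (i : ℕ) : ℝ)) with hg
  set k : ℝ → Fin n → ℂ := fun ε j => Complex.exp (-κ * (ε * (j : ℕ) : ℝ)) with hk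
  set U : ℝ → Fin n → ℂ := fun ε i => g ε i ^ 2 with hU
  set V : ℝ → Fin n → ℂ := fun ε j => v * k ε j ^ 2 with hV
  set φ : ℝ → ℝ := fun s => c / (a s * b s) with hφ
  set ψ : ℝ → ℝ := fun s => 1 / a s + 1 / b s with hψ
  set F : ℂ := ∏ j ∈ Finset.range n, (j.factorial : ℂ) with hF
  have hg0 : ∀ ε i, g ε i ≠ 0 := fun _ _ => Complex.exp_ne_zero _
  have hk0 : ∀ ε i, k ε i ≠ 0 := fun _ _ => Complex.exp_ne_zero _
  have hgc : Continuous g := by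
    refine continuous_pi fun i => ?_
    fun_prop
  have hkc : Continuous k := by
    refine continuous_pi fun i => ?_
    fun_prop
  have hgc' : ∀ i, Continuous fun ε => g ε i := fun i => (continuous_apply i).comp hgc
  have hkc' : ∀ i, Continuous fun ε => k ε i := fun i => (continuous_apply i).comp hkc
  have hac : Continuous a := (has 0).continuous
  have hbc : Continuous b := (hbs 0).continuous
  have hwA : ∀ ε i j, weightA p q (U ε i) (V ε j) =
      μ * (g ε i * k ε j) * a (t + ε * ((i : ℝ) + j)) := by
    intro ε i j
    rw [mul_add, ← add_assoc]
    exact ha (t + ε * (i : ℕ)) (ε * (j : ℕ))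
  have hwB : ∀ ε i j, weightA q p (U ε i) (V ε j) =
      μ * (g ε i * k ε j) * b (t + ε * ((i : ℝ) + j)) := by
    intro ε i j
    rw [mul_add, ← add_assoc]
    exact hb (t + ε * (i : ℕ)) (ε * (j : ℕ))
  -- For small nonzero `ε` the parameters are generic.
  have hane : ∀ i j : Fin n, ∀ᶠ ε in 𝓝[≠] (0 : ℝ), a (t + ε * ((i : ℝ) + j)) ≠ 0 := by
    intro i j
    have : Continuous fun ε : ℝ => a (t + ε * ((i : ℝ) + j)) := by fun_prop
    exact (this.continuousAt.eventually_ne (by simpa using hat)).filter_mono nhdsWithin_le_nhds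
  have hbne : ∀ i j : Fin n, ∀ᶠ ε in 𝓝[≠] (0 : ℝ), b (t + ε * ((i : ℝ) + j)) ≠ 0 := by
    intro i j
    have : Continuous fun ε : ℝ => b (t + ε * ((i : ℝ) + j)) := by fun_prop
    exact (this.continuousAt.eventually_ne (by simpa using hbt)).filter_mono nhdsWithin_le_nhds
  have hqne : ∀ i j : Fin n, ∀ᶠ ε in 𝓝[≠] (0 : ℝ), q ^ 2 * U ε i - p ^ 2 * U ε j ≠ 0 := by
    intro i j
    have h1 : Continuous fun ε : ℝ => q ^ 2 * U ε i - p ^ 2 * U ε j := by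
      have := hgc' i
      have := hgc' j
      simp only [hU]
      fun_prop
    refine (h1.continuousAt.eventually_ne ?_).filter_mono nhdsWithin_le_nhds
    have h2 : q ^ 2 - p ^ 2 ≠ 0 := fun h0 => by
      rw [h0] at hc
      refine mul_ne_zero (pow_ne_zero 2 hμ0) (pow_ne_zero 2 hcC) ?_
      rw [← hc]
      ring
    have h3 : q ^ 2 * U 0 i - p ^ 2 * U 0 j =
        (q ^ 2 - p ^ 2) * Complex.exp (κ * t) ^ 2 := by
      simp [hU, hg]
      ring
    rw [h3]
    exact mul_ne_zero h2 (pow_ne_zero 2 (Complex.exp_ne_zero _))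
  have hUexp : ∀ ε, U ε = fun i : Fin n =>
      Complex.exp (κ * t) ^ 2 * Complex.exp (2 * κ * ε * (i : ℕ)) := by
    intro ε
    funext i
    simp only [hU, hg]
    rw [← Complex.exp_nat_mul, ← Complex.exp_nat_mul, ← Complex.exp_add]
    congr 1
    push_cast
    ring
  have hVexp : ∀ ε, V ε = fun i : Fin n =>
      v * Complex.exp (-(2 * κ) * ε * (i : ℕ)) := by
    intro ε
    funext i
    simp only [hV, hk]
    rw [← Complex.exp_nat_mul]
    congr 2
    push_cast
    ring
  have hF0 : F ≠ 0 := Finset.prod_ne_zero_iff.2 fun j _ => Nat.cast_ne_zero.2 j.factorial_ne_zero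
  have hUlim := tendsto_det_vandermonde n (Complex.exp (κ * t) ^ 2) (2 * κ)
  have hVlim := tendsto_det_vandermonde n v (-(2 * κ))
  simp only [← hUexp, ← hVexp, ← hF] at hUlim hVlim
  have hinj : ∀ W : ℝ → Fin n → ℂ, ∀ l : ℂ, l ≠ 0 →
      Tendsto (fun ε : ℝ => (vandermonde (W ε)).det / ((∏ i : Fin n, ε ^ (i : ℕ) : ℝ) : ℂ))
        (𝓝[≠] 0) (𝓝 l) → ∀ᶠ ε in 𝓝[≠] (0 : ℝ), Function.Injective (W ε) := by
    intro W l hl hW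
    filter_upwards [hW.eventually_ne hl] with ε hε
    exact det_vandermonde_ne_zero_iff.1 fun h0 => hε (by rw [h0, zero_div])
  have hUinj := hinj U _ (mul_ne_zero (Finset.prod_ne_zero_iff.2 fun i _ => pow_ne_zero _
    (mul_ne_zero (pow_ne_zero 2 (Complex.exp_ne_zero _)) (mul_ne_zero two_ne_zero hκ))) hF0) hUlim
  have hVinj := hinj V _ (mul_ne_zero (Finset.prod_ne_zero_iff.2 fun i _ => pow_ne_zero _
    (mul_ne_zero hv (neg_ne_zero.2 (mul_ne_zero two_ne_zero hκ)))) hF0) hVlim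
  -- A convex open neighbourhood of `t` on which both functions are smooth.
  obtain ⟨δ, hδ, hball⟩ : ∃ δ > 0, ∀ x ∈ Metric.ball t δ, a x ≠ 0 ∧ b x ≠ 0 :=
    Metric.eventually_nhds_iff_ball.1
      ((hac.continuousAt.eventually_ne hat).and (hbc.continuousAt.eventually_ne hbt))
  have hφs : ∀ m : ℕ, ContDiffOn ℝ m φ (Metric.ball t δ) := fun m =>
    contDiffOn_const.div ((has m).mul (hbs m)).contDiffOn fun x hx =>
      mul_ne_zero (hball x hx).1 (hball x hx).2
  have hψs : ∀ m : ℕ, ContDiffOn ℝ m ψ (Metric.ball t δ) := fun m =>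
    (contDiffOn_const.div (has m).contDiffOn fun x hx => (hball x hx).1).add
      (contDiffOn_const.div (hbs m).contDiffOn fun x hx => (hball x hx).2)
  have hφlim := tendsto_det_hankel (n := n) Metric.isOpen_ball (convex_ball t δ)
    (Metric.mem_ball_self hδ) hφs
  have hψlim := tendsto_det_hankel (n := n) Metric.isOpen_ball (convex_ball t δ)
    (Metric.mem_ball_self hδ) hψs
  have hφlim' := (Complex.continuous_ofReal.tendsto _).comp hφlim
  have hψlim' := (Complex.continuous_ofReal.tendsto _).comp hψlim
  have hZlim : Tendsto (fun ε => inhomogeneousZ p q (U ε) (V ε)) (𝓝[≠] 0)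
      (𝓝 (inhomogeneousZ p q (U 0) (V 0))) :=
    ((continuous_inhomogeneousZ p q (hgc.pow 2) (continuous_const.mul (hkc.pow 2))).tendsto
      0).mono_left nhdsWithin_le_nhds
  have hpre : Continuous fun ε => (∏ i : Fin n, ∏ j : Fin n,
      weightA p q (U ε i) (V ε j) * weightA q p (U ε i) (V ε j)) ^ 2 *
      ((∏ i, (μ ^ 2 * c * g ε i ^ 2)⁻¹) * (∏ j, (k ε j ^ 2)⁻¹) *
      ((∏ i, (μ * g ε i)⁻¹) * ∏ j, (k ε j)⁻¹)) := by
    simp only [hwA, hwB]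
    refine Continuous.mul ?_ (Continuous.mul (Continuous.mul ?_ ?_) (Continuous.mul ?_ ?_))
    · refine Continuous.pow (continuous_finsetProd _ fun i _ => continuous_finsetProd _
        fun j _ => ?_) 2
      have := hgc' i
      have := hkc' j
      fun_prop
    · refine continuous_finsetProd _ fun i _ => Continuous.inv₀ ?_ fun ε =>
        mul_ne_zero (mul_ne_zero (pow_ne_zero 2 hμ0) hcC) (pow_ne_zero 2 (hg0 ε i))
      have := hgc' i
      fun_prop
    · exact continuous_finsetProd _ fun j _ => ((hkc' j).pow 2).inv₀ fun ε =>
        pow_ne_zero 2 (hk0 ε j)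
    · refine continuous_finsetProd _ fun i _ => Continuous.inv₀ ?_ fun ε =>
        mul_ne_zero hμ0 (hg0 ε i)
      have := hgc' i
      fun_prop
    · exact continuous_finsetProd _ fun j _ => (hkc' j).inv₀ (hk0 · j)
  have hL := hZlim.mul ((hUlim.pow 2).mul (hVlim.pow 2))
  have hR := ((hpre.tendsto 0).mono_left nhdsWithin_le_nhds).mul (hφlim'.mul hψlim')
  have heq := tendsto_nhds_unique_of_eventuallyEq hL hR ?_
  · -- Evaluate both limits.
    set w : ℂ := μ * Complex.exp (κ * t) with hw
    have hw0 : w ≠ 0 := mul_ne_zero hμ0 (Complex.exp_ne_zero _)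
    have hgz : ∀ i, g 0 i = Complex.exp (κ * t) := fun i => by simp [hg]
    have hkz : ∀ i, k 0 i = 1 := fun i => by simp [hk]
    have hZ0 : inhomogeneousZ p q (U 0) (V 0) =
        homogeneousZ n (w * a t) (w * b t) 1 ((w * c) ^ 2) := by
      unfold inhomogeneousZ homogeneousZ
      rw [← List.ofFn_const]
      congr 2
      funext i
      unfold spectralTransfer spectralOp
      congr 1
      funext j
      have e1 := hwA 0 i j
      have e2 := hwB 0 i j
      simp only [weightA, hgz, hkz, mul_one, zero_mul, add_zero] at e1 e2
      rw [e1, e2]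
      congr 1
      simp only [hU, hV, hgz, hkz, hw]
      linear_combination Complex.exp (κ * t) ^ 2 * hc
    have hD : (∏ i : Fin n, (Complex.exp (κ * t) ^ 2 * (2 * κ)) ^ (i : ℕ)) ^ 2 *
        (∏ i : Fin n, (v * -(2 * κ)) ^ (i : ℕ)) ^ 2 = (∏ i : Fin n, w ^ (i : ℕ)) ^ 4 := by
      simp only [← Finset.prod_pow, ← Finset.prod_mul_distrib]
      refine Finset.prod_congr rfl fun i _ => ?_
      rw [← pow_mul, ← pow_mul, ← pow_mul, mul_comm (i : ℕ), mul_comm (i : ℕ), pow_mul, pow_mul,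
        pow_mul, ← mul_pow]
      congr 1
      simp only [hw]
      linear_combination -(Complex.exp (κ * t)) ^ 4 * (μ ^ 2 + 4 * κ ^ 2 * v) * hμ
    have hDw := prod_pow_sq_mul_pow n w
    have hgauge := homogeneousZ_gauge n w (a t : ℂ) (b t) c
    have hmap := homogeneousZ_map Complex.ofRealHom n (a t) (b t) c c
    simp only [Complex.ofRealHom_eq_coe] at hmap
    simp only [hwA, hwB, hgz, hkz, mul_one, zero_mul, add_zero, one_pow, inv_one,
      Finset.prod_const, Finset.card_univ, Fintype.card_fin, one_pow] at heq
    rw [hZ0] at heq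
    set D := ∏ i : Fin n, w ^ (i : ℕ)
    set Z1 := homogeneousZ n (w * a t) (w * b t) 1 ((w * (c : ℂ)) ^ 2)
    set H1 : ℂ := ((hankelDet n φ t : ℝ) : ℂ)
    set H2 : ℂ := ((hankelDet n ψ t : ℝ) : ℂ)
    apply Complex.ofReal_injective
    push_cast
    rw [← hmap, Finset.prod_pow, ← hF]
    have hexp : (((w * a t * (w * b t)) ^ n) ^ n) ^ 2 =
        (w ^ (n ^ 2)) ^ 4 * ((a t : ℂ) * b t) ^ (2 * n ^ 2) := by
      rw [← pow_mul, ← pow_mul, ← pow_mul, show n ^ 2 * 4 = 2 * (2 * n ^ 2) by ring, pow_mul w,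
        ← mul_pow]
      rw [show n * (n * 2) = 2 * n ^ 2 by ring]
      congr 1
      ring
    have heq' : Z1 * (D ^ 4 * F ^ 4) = (w ^ (n ^ 2)) ^ 4 * ((a t : ℂ) * b t) ^ (2 * n ^ 2) *
        (((w ^ 2 * c) ^ n)⁻¹ * (w ^ n)⁻¹) * (H1 * H2) := by
      rw [← hexp, ← hD]
      rw [show w ^ 2 * (c : ℂ) = μ ^ 2 * c * Complex.exp (κ * t) ^ 2 by simp only [hw]; ring,
        ← inv_pow, ← inv_pow]
      refine Eq.trans ?_ heq
      ring
    have hwn : w ^ n ≠ 0 := pow_ne_zero _ hw0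
    have hcn : (c : ℂ) ^ n ≠ 0 := pow_ne_zero _ hcC
    have hwn2 : w ^ (n ^ 2) ≠ 0 := pow_ne_zero _ hw0
    have hgauge' : w ^ n * (c : ℂ) ^ n * Z1 =
        (w ^ (n ^ 2)) ^ 2 * homogeneousZ n (a t : ℂ) (b t) c c := by
      rw [← mul_pow, hgauge, ← pow_mul, mul_comm 2]
    have heq'' : Z1 * (D ^ 4 * F ^ 4) * ((w ^ n) ^ 3 * (c : ℂ) ^ n) =
        (w ^ (n ^ 2)) ^ 4 * ((a t : ℂ) * b t) ^ (2 * n ^ 2) * (H1 * H2) := by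
      rw [heq', mul_pow (w ^ 2) (c : ℂ), ← pow_mul w 2 n, mul_comm 2 n, pow_mul w n 2]
      clear_value w
      field_simp
    refine mul_left_cancel₀ (pow_ne_zero 4 hwn2) ?_
    set X := w ^ n
    set Y := w ^ (n ^ 2)
    set Z := homogeneousZ n (a t : ℂ) (b t) c c
    -- `D ^ 2 * X = Y` turns the powers of `w` on the left into those on the right.
    linear_combination heq'' - D ^ 4 * F ^ 4 * X ^ 2 * hgauge' -
      Y ^ 2 * Z * F ^ 4 * (D ^ 2 * X + Y) * hDw
  · filter_upwards [hUinj, hVinj, eventually_all.2 fun i => eventually_all.2 (hane i),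
      eventually_all.2 fun i => eventually_all.2 (hbne i),
      eventually_all.2 fun i => eventually_all.2 (hqne i)] with ε h1 h2 h3 h4 h5
    have hA0 : ∀ i j, weightA p q (U ε i) (V ε j) ≠ 0 := fun i j => by
      rw [hwA]
      exact mul_ne_zero (mul_ne_zero hμ0 (mul_ne_zero (hg0 _ _) (hk0 _ _)))
        (Complex.ofReal_ne_zero.2 (h3 i j))
    have hB0 : ∀ i j, weightA q p (U ε i) (V ε j) ≠ 0 := fun i j => by
      rw [hwB]
      exact mul_ne_zero (mul_ne_zero hμ0 (mul_ne_zero (hg0 _ _) (hk0 _ _)))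
        (Complex.ofReal_ne_zero.2 (h4 i j))
    have hdet := detFormula h h1 h2 h5 hA0 hB0
    unfold DetFormula at hdet
    -- The factors `μ`, `g ε i`, `k ε j` are common to rows and columns.
    have d1 : (Matrix.of fun i j : Fin n =>
        1 / (weightA p q (U ε i) (V ε j) * weightA q p (U ε i) (V ε j))).det =
        (∏ i, (μ ^ 2 * c * g ε i ^ 2)⁻¹) * ((∏ j, (k ε j ^ 2)⁻¹) *
        (((Matrix.of fun i j : Fin n => φ (t + ε * ((i : ℝ) + j))).det : ℝ) : ℂ)) := by
      rw [ofReal_det, ← det_mul_row, ← det_mul_column]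
      congr 1
      ext i j
      have := hg0 ε i
      have := hk0 ε j
      simp only [of_apply, hwA, hwB, map_apply, hφ]
      push_cast
      have h3' := Complex.ofReal_ne_zero.2 (h3 i j)
      have h4' := Complex.ofReal_ne_zero.2 (h4 i j)
      field_simp
    have d2 : (Matrix.of fun i j : Fin n =>
        1 / weightA p q (U ε i) (V ε j) + 1 / weightA q p (U ε i) (V ε j)).det =
        (∏ i, (μ * g ε i)⁻¹) * ((∏ j, (k ε j)⁻¹) *
        (((Matrix.of fun i j : Fin n => ψ (t + ε * ((i : ℝ) + j))).det : ℝ) : ℂ)) := by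
      rw [ofReal_det, ← det_mul_row, ← det_mul_column]
      congr 1
      ext i j
      have := hg0 ε i
      have := hk0 ε j
      simp only [of_apply, hwA, hwB, map_apply, hψ]
      push_cast
      have h3' := Complex.ofReal_ne_zero.2 (h3 i j)
      have h4' := Complex.ofReal_ne_zero.2 (h4 i j)
      field_simp
    rw [d1, d2] at hdet
    simp only [Function.comp_apply, Complex.ofReal_div, Complex.ofReal_pow]
    linear_combination (1 / ((∏ i : Fin n, ε ^ (i : ℕ) : ℝ) : ℂ) ^ 4) * hdet

/-! ### States as paths of transfer matrices -/

/-- Entries of a product of matrices are sums over paths. -/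
theorem prod_ofFn_apply {ι K : Type*} [Fintype ι] [DecidableEq ι] [CommRing K] :
    ∀ {m : ℕ} (M : Fin m → Matrix ι ι K) (s t : ι), (List.ofFn M).prod s t =
      ∑ h : Fin (m + 1) → ι, if h 0 = s ∧ h (Fin.last m) = t then
        ∏ j : Fin m, M j (h j.castSucc) (h j.succ) else 0
  | 0, M, s, t => by
    rw [sum_cons]
    simp only [List.ofFn_zero, List.prod_nil, one_apply, Finset.univ_eq_empty, Finset.prod_empty,
      Finset.univ_unique, Finset.sum_singleton]
    have : ∀ x, (Fin.cons x (default : Fin 0 → ι) : Fin 1 → ι) (Fin.last 0) = x := fun x => rfl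
    simp only [Fin.cons_zero, this, ite_and, Finset.sum_ite_eq', Finset.mem_univ, if_true]
  | m + 1, M, s, t => by
    rw [List.ofFn_succ, List.prod_cons, mul_apply, sum_cons]
    simp only [prod_ofFn_apply, Fin.cons_zero, ← Fin.succ_last, Fin.cons_succ, Fin.prod_univ_succ,
      Fin.castSucc_zero, ← Fin.succ_castSucc, ite_and, Finset.mul_sum]
    rw [Finset.sum_comm, Finset.sum_comm (γ := ι)]
    refine Finset.sum_congr rfl fun h _ => ?_
    simp only [mul_ite, mul_zero, Finset.sum_ite_eq, Finset.sum_ite_eq', Finset.mem_univ, if_true]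

/-- Arrows on `2n` columns, grouped into mirror pairs of columns. -/
def mirrorPairs (n : ℕ) : (Fin (2 * n) → Bool) ≃ (Fin n → Bool × Bool) where
  toFun y j := (y (j.castLE (by omega)), y (j.castLE (by omega)).rev)
  invFun s j := if h : (j : ℕ) < n then (s ⟨j, h⟩).1 else (s ⟨j.rev, by
    rw [Fin.val_rev]; omega⟩).2
  left_inv y := by
    funext j
    dsimp only
    split_ifs with h
    · rfl
    · exact congrArg y (Fin.rev_rev j)
  right_inv s := by
    funext j
    have h : ¬ ((j.castLE (by omega : n ≤ 2 * n)).rev : ℕ) < n := by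
      rw [Fin.val_rev, Fin.val_castLE]; omega
    refine Prod.ext ?_ ?_
    · simp
    · simp only [h, dif_neg, not_false_iff, Fin.rev_rev]
      rfl

theorem rowOp_mirrorPairs {K : Type*} [CommRing K] (L : Bool → Bool → Matrix Bool Bool K) :
    ∀ {n : ℕ} (y y' : Fin (2 * n) → Bool),
    rowOp n (fun _ => L) (mirrorPairs n y) (mirrorPairs n y') =
      (List.ofFn fun j => L (y j) (y' j)).prod
  | 0, _, _ => by simp [rowOp]
  | n + 1, y, y' => by
    have hs : ∀ y : Fin (2 * (n + 1)) → Bool, (fun j : Fin n => mirrorPairs (n + 1) y j.succ) =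
        mirrorPairs n fun j : Fin (2 * n) => y (Fin.castSucc j).succ := by
      intro y
      funext j
      refine Prod.ext (congrArg y (Fin.ext rfl)) (congrArg y (Fin.ext ?_))
      simp only [Fin.val_rev, Fin.val_castLE, Fin.val_succ, Fin.val_castSucc]
      omega
    simp only [rowOp, hs, rowOp_mirrorPairs L]
    have hl : (List.ofFn fun j : Fin (2 * (n + 1)) => L (y j) (y' j)) =
        List.ofFn fun j : Fin (2 * n + 1 + 1) => L (y j) (y' j) := rfl
    rw [hl, List.ofFn_succ, List.ofFn_succ', List.concat_eq_append, List.prod_cons,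
      List.prod_append, List.prod_singleton, ← mul_assoc]
    rfl

/-- The partition function as a sum over the horizontal arrows `x` and vertical arrows `y` of the
upper half of the lattice. -/
theorem homogeneousZ_eq_sum {K : Type*} [CommRing K] (n : ℕ) (a b c d : K) :
    homogeneousZ n a b c d =
      ∑ x : (Fin n → Fin (2 * n + 1) → Bool) × (Fin (n + 1) → Fin (2 * n) → Bool),
        if (∀ i, x.1 i 0 = false ∧ x.1 i (Fin.last _) = true) ∧ (∀ j, x.2 0 j = false) ∧
          (∀ j, x.2 (Fin.last n) j.rev = !x.2 (Fin.last n) j) then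
        ∏ i : Fin n, ∏ j : Fin (2 * n), (vertexType (x.1 i j.castSucc) (x.1 i j.succ)
          (x.2 i.castSucc j) (x.2 i.succ j)).elim 0 ![a, a, b, b, c, d] else 0 := by
  -- The sum over `g` in `halfTurnSum` encodes that arrows in mirror columns are opposite.
  have hmid : ∀ y : Fin (2 * n) → Bool, (∃! g : Fin n → Bool, mirrorPairs n y =
      fun j => (g j, !g j)) ↔ ∀ j, y j.rev = !y j := by
    intro y
    constructor
    · rintro ⟨g, hg, -⟩ j
      by_cases h : (j : ℕ) < n
      · have := congrFun hg ⟨j, h⟩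
        have h1 : y j = g ⟨j, h⟩ := congrArg Prod.fst this
        have h2 : y j.rev = !g ⟨j, h⟩ := congrArg Prod.snd this
        rw [h1, h2]
      · have hr : (j.rev : ℕ) < n := by rw [Fin.val_rev]; omega
        have := congrFun hg ⟨j.rev, hr⟩
        have h1 : y j.rev = g ⟨j.rev, hr⟩ := congrArg Prod.fst this
        have h2 : y j.rev.rev = !g ⟨j.rev, hr⟩ := congrArg Prod.snd this
        rw [Fin.rev_rev] at h2
        rw [h1, h2, Bool.not_not]
    · intro h
      refine ⟨fun j => (mirrorPairs n y j).1, funext fun j => Prod.ext rfl (h _), fun g hg => ?_⟩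
      simp [hg]
  unfold homogeneousZ halfTurnSum
  simp only [← List.ofFn_const, prod_ofFn_apply]
  rw [Finset.sum_comm, Fintype.sum_prod_type_right]
  refine (Fintype.sum_equiv (Equiv.piCongrRight fun _ => mirrorPairs n) _ _ fun y => ?_).symm
  have hdown : mirrorPairs n (y 0) = (fun _ => (false, false)) ↔ ∀ j, y 0 j = false := by
    rw [show (fun _ => (false, false)) = mirrorPairs n fun _ => false from rfl,
      (mirrorPairs n).injective.eq_iff]
    exact funext_iff
  simp only [Equiv.piCongrRight_apply, Pi.map_apply, transfer, of_apply, rowOp_mirrorPairs,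
    prod_ofFn_apply, hdown]
  rw [Finset.prod_univ_sum, Fintype.piFinset_univ]
  simp only [Finset.prod_ite_zero, Finset.mem_univ, true_imp_iff, vertexOp, of_apply]
  by_cases h0 : ∀ j, y 0 j = false
  · by_cases h1 : ∀ j, y (Fin.last n) j.rev = !y (Fin.last n) j
    · obtain ⟨g, hg, hgu⟩ := (hmid _).2 h1
      rw [Finset.sum_eq_single_of_mem g (Finset.mem_univ _)]
      · simp only [h0, h1, hg, implies_true, and_true, if_true]
      · intro g' _ hg'
        rw [if_neg]
        exact fun h => hg' (hgu g' h.2)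
    · have h2 : ∀ g : Fin n → Bool, mirrorPairs n (y (Fin.last n)) ≠ fun j => (g j, !g j) := by
        intro g hg
        refine h1 ((hmid _).1 ⟨g, hg, fun g' hg' => ?_⟩)
        funext j
        exact (congrArg Prod.fst (congrFun (hg'.symm.trans hg) j))
      simp only [h1, h2, and_false, if_false, Finset.sum_const_zero]
  · simp only [h0, false_and, and_false, if_false, Finset.sum_const_zero]

/-! ### Reduction of half-turn symmetric states to the upper half -/

/-- The arrows of the upper half of the lattice, including the middle line. -/
def upperHalf {n : ℕ} (σ : ArrowConfig (2 * n)) :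
    (Fin n → Fin (2 * n + 1) → Bool) × (Fin (n + 1) → Fin (2 * n) → Bool) :=
  (fun i => σ.1 (i.castLE (by omega)), fun i => σ.2 (i.castLE (by omega)))

/-- The extension of the arrows in the upper half by rotation. -/
def extendHalf {n : ℕ}
    (x : (Fin n → Fin (2 * n + 1) → Bool) × (Fin (n + 1) → Fin (2 * n) → Bool)) :
    ArrowConfig (2 * n) :=
  (fun i j => if h : (i : ℕ) < n then x.1 ⟨i, h⟩ j else
      !x.1 ⟨i.rev, by rw [Fin.val_rev]; omega⟩ j.rev,
    fun i j => if h : (i : ℕ) < n + 1 then x.2 ⟨i, h⟩ j else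
      !x.2 ⟨i.rev, by rw [Fin.val_rev]; omega⟩ j.rev)

theorem vertexType_rotate (w : Fin 6 → ℝ) (h12 : w 0 = w 1) (h34 : w 2 = w 3) (l r t m : Bool) :
    (vertexType (!r) (!l) (!m) (!t)).elim 0 w = (vertexType l r t m).elim 0 w := by
  cases l <;> cases r <;> cases t <;> cases m <;> simp [vertexType, h12, h34]

theorem weight_eq_zero_of_not_iceRule {N : ℕ} (w : Fin 6 → ℝ) {σ : ArrowConfig N}
    (h : ¬ IceRule σ) : weight w σ = 0 := by
  simp only [IceRule, inDegree_eq_two_iff, not_forall] at h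
  obtain ⟨i, j, hij⟩ := h
  refine Finset.prod_eq_zero (Finset.mem_univ i) (Finset.prod_eq_zero (Finset.mem_univ j) ?_)
  rw [typeAt, Option.not_isSome_iff_eq_none.1 hij]
  rfl

theorem prod_two_mul {M : Type*} [CommMonoid M] (n : ℕ) (f : Fin (2 * n) → M)
    (hf : ∀ i, f i.rev = f i) : ∏ i, f i = ∏ i : Fin n, f (i.castLE (by omega)) ^ 2 := by
  rw [← Fin.prod_congr' f (two_mul n).symm, Fin.prod_univ_add,
    ← Equiv.prod_comp Fin.revPerm fun i : Fin n => f ((Fin.natAdd n i).cast _),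
    ← Finset.prod_mul_distrib]
  refine Finset.prod_congr rfl fun i _ => ?_
  rw [sq, ← hf (i.castLE _)]
  congr 1
  · rw [hf]
    rfl
  · refine congrArg f (Fin.ext ?_)
    simp only [Fin.revPerm_apply, Fin.val_cast, Fin.val_natAdd, Fin.val_rev, Fin.val_castLE]
    omega

/-- A vertex and its image under the rotation have the same weight, so the weight of the state is
the product of the squared weights in the upper half. -/
theorem weight_of_rotate_eq {n : ℕ} {w : Fin 6 → ℝ} (h12 : w 0 = w 1) (h34 : w 2 = w 3)
    {σ : ArrowConfig (2 * n)} (hσ : rotate σ = σ) :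
    weight w σ = ∏ i : Fin n, ∏ j : Fin (2 * n), (vertexType ((upperHalf σ).1 i j.castSucc)
      ((upperHalf σ).1 i j.succ) ((upperHalf σ).2 i.castSucc j)
      ((upperHalf σ).2 i.succ j)).elim 0 (fun k => w k ^ 2) := by
  have hx : ∀ i j, σ.1 i.rev j.rev = !σ.1 i j := fun i j => by
    have := congrFun (congrFun (congrArg Prod.fst hσ) i.rev) j.rev
    simpa [rotate] using this.symm
  have hy : ∀ i j, σ.2 i.rev j.rev = !σ.2 i j := fun i j => by
    have := congrFun (congrFun (congrArg Prod.snd hσ) i.rev) j.rev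
    simpa [rotate] using this.symm
  unfold weight
  rw [prod_two_mul]
  · refine Finset.prod_congr rfl fun i _ => ?_
    rw [← Finset.prod_pow]
    refine Finset.prod_congr rfl fun j _ => ?_
    have ho : ∀ o : Option (Fin 6), (o.elim 0 w) ^ 2 = o.elim 0 fun k => w k ^ 2 := by
      rintro (_ | k) <;> simp
    exact ho _
  · intro i
    rw [← Equiv.prod_comp Fin.revPerm]
    refine Finset.prod_congr rfl fun j _ => ?_
    simp only [typeAt, Fin.revPerm_apply]
    rw [← vertexType_rotate w h12 h34 (σ.1 i j.castSucc), ← hx, ← hx, ← hy, ← hy, Fin.rev_succ,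
      Fin.rev_castSucc, Fin.rev_succ, Fin.rev_castSucc]

theorem upperHalf_extendHalf {n : ℕ}
    (x : (Fin n → Fin (2 * n + 1) → Bool) × (Fin (n + 1) → Fin (2 * n) → Bool)) :
    upperHalf (extendHalf x) = x := by
  refine Prod.ext (funext fun i => funext fun j => ?_) (funext fun i => funext fun j => ?_)
  · exact dif_pos i.isLt
  · exact dif_pos i.isLt

theorem extendHalf_upperHalf {n : ℕ} {σ : ArrowConfig (2 * n)} (h : rotate σ = σ) :
    extendHalf (upperHalf σ) = σ := by
  refine Prod.ext (funext fun i => funext fun j => ?_) (funext fun i => funext fun j => ?_)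
  · simp only [extendHalf, upperHalf]
    split_ifs
    · rfl
    · exact congrFun (congrFun (congrArg Prod.fst h) i) j
  · simp only [extendHalf, upperHalf]
    split_ifs
    · rfl
    · exact congrFun (congrFun (congrArg Prod.snd h) i) j

theorem domainWall_extendHalf {n : ℕ}
    {x : (Fin n → Fin (2 * n + 1) → Bool) × (Fin (n + 1) → Fin (2 * n) → Bool)}
    (h1 : ∀ i, x.1 i 0 = false ∧ x.1 i (Fin.last _) = true) (h2 : ∀ j, x.2 0 j = false) :
    DomainWall (extendHalf x) := by
  refine ⟨fun i => ?_, fun j => ?_⟩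
  · by_cases h : (i : ℕ) < n
    · simp [extendHalf, h, h1]
    · simp [extendHalf, h, h1]
  · have hn : 0 < n := by have := j.isLt; omega
    have h : ¬ (2 * n < n + 1) := by omega
    have h0 : (⟨(Fin.last (2 * n)).rev, by simp⟩ : Fin (n + 1)) = 0 := Fin.ext (by simp)
    constructor
    · simpa [extendHalf] using h2 j
    · simp only [extendHalf, Fin.val_last, h, dif_neg, not_false_iff, h0, h2, Bool.not_false]

theorem rotate_extendHalf {n : ℕ}
    {x : (Fin n → Fin (2 * n + 1) → Bool) × (Fin (n + 1) → Fin (2 * n) → Bool)}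
    (h : ∀ j, x.2 (Fin.last n) j.rev = !x.2 (Fin.last n) j) :
    rotate (extendHalf x) = extendHalf x := by
  refine Prod.ext (funext fun i => funext fun j => ?_) (funext fun i => funext fun j => ?_)
  · simp only [rotate, extendHalf]
    by_cases hi : (i : ℕ) < n
    · have hr : ¬ (i.rev : ℕ) < n := by rw [Fin.val_rev]; omega
      simp only [hi, hr, dif_pos, dif_neg, not_false_iff, Fin.rev_rev, Bool.not_not]
    · have hr : (i.rev : ℕ) < n := by rw [Fin.val_rev]; omega
      simp only [hi, hr, dif_pos, dif_neg, not_false_iff]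
  · simp only [rotate, extendHalf]
    rcases lt_trichotomy (i : ℕ) n with hi | hi | hi
    · have hi' : (i : ℕ) < n + 1 := by omega
      have hr : ¬ (i.rev : ℕ) < n + 1 := by rw [Fin.val_rev]; omega
      simp only [hi', hr, dif_pos, dif_neg, not_false_iff, Fin.rev_rev, Bool.not_not]
    · -- The middle line is its own image.
      have hi' : (i : ℕ) < n + 1 := by omega
      have hr : (i.rev : ℕ) < n + 1 := by rw [Fin.val_rev]; omega
      have e1 : (⟨i, hi'⟩ : Fin (n + 1)) = Fin.last n := Fin.ext hi
      have e2 : (⟨i.rev, hr⟩ : Fin (n + 1)) = Fin.last n := Fin.ext (by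
        simp only [Fin.val_rev, Fin.val_last]; omega)
      simp only [hi', hr, dif_pos, e1, e2, h, Bool.not_not]
    · have hi' : ¬ (i : ℕ) < n + 1 := by omega
      have hr : (i.rev : ℕ) < n + 1 := by rw [Fin.val_rev]; omega
      simp only [hi', hr, dif_pos, dif_neg, not_false_iff]

theorem partitionHT_eq_homogeneousZ (n : ℕ) {a b c : ℝ} (ha : 0 ≤ a) (hb : 0 ≤ b) (hc : 0 ≤ c) :
    partitionHT n ![√a, √a, √b, √b, √c, √c] = homogeneousZ n a b c c := by
  classical
  have hsub : partitionHT n ![√a, √a, √b, √b, √c, √c] =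
      ∑ σ : ArrowConfig (2 * n) with DomainWall σ ∧ rotate σ = σ,
        weight ![√a, √a, √b, √b, √c, √c] σ := by
    unfold partitionHT
    refine Finset.sum_subset_zero_on_sdiff (fun σ hσ => ?_) (fun σ hσ => ?_) fun _ _ => rfl
    · simp only [Finset.mem_filter, Finset.mem_univ, true_and] at hσ ⊢
      exact hσ.2
    · simp only [Finset.mem_sdiff, Finset.mem_filter, Finset.mem_univ, true_and] at hσ
      exact weight_eq_zero_of_not_iceRule _ fun h => hσ.2 ⟨h, hσ.1⟩
  have hw : (fun k => (![√a, √a, √b, √b, √c, √c] : Fin 6 → ℝ) k ^ 2) = ![a, a, b, b, c, c] := by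
    funext k
    fin_cases k <;> simp [Real.sq_sqrt, ha, hb, hc]
  rw [hsub, homogeneousZ_eq_sum, ← Finset.sum_filter]
  refine Finset.sum_bij' (fun σ _ => upperHalf σ) (fun x _ => extendHalf x) ?_ ?_ ?_ ?_ ?_
  · intro σ hσ
    simp only [Finset.mem_filter, Finset.mem_univ, true_and] at hσ ⊢
    obtain ⟨⟨h1, h2⟩, h3⟩ := hσ
    refine ⟨fun i => h1 _, fun j => (h2 j).1, fun j => ?_⟩
    have := congrFun (congrFun (congrArg Prod.snd h3) ((Fin.last n).castLE (by omega))) j.rev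
    simp only [rotate, Fin.rev_rev] at this
    refine this.symm.trans (congrArg (fun i => !σ.2 i j) (Fin.ext ?_))
    simp only [Fin.val_rev, Fin.val_castLE, Fin.val_last]
    omega
  · intro x hx
    simp only [Finset.mem_filter, Finset.mem_univ, true_and] at hx ⊢
    exact ⟨domainWall_extendHalf hx.1 hx.2.1, rotate_extendHalf hx.2.2⟩
  · intro σ hσ
    simp only [Finset.mem_filter, Finset.mem_univ, true_and] at hσ
    exact extendHalf_upperHalf hσ.2
  · intro x _
    exact upperHalf_extendHalf x
  · intro σ hσ
    simp only [Finset.mem_filter, Finset.mem_univ, true_and] at hσ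
    rw [weight_of_rotate_eq rfl rfl hσ.2, hw]

/-! ### The three phases -/

/-- The formula, given the complex data that turn the weights into multiplicative form. -/
theorem partitionHT_eq_of_parametrization {p q κ v μ : ℂ} {a b : ℝ → ℝ} {c t : ℝ} (n : ℕ)
    (h : p * q = 1) (hκ : κ ≠ 0) (hv : v ≠ 0) (hμ : μ ^ 2 = 4 * κ ^ 2 * v)
    (hc : (q ^ 2 - p ^ 2) ^ 2 * v = μ ^ 2 * (c : ℂ) ^ 2)
    (ha : ∀ x y : ℝ, p * Complex.exp (κ * x) ^ 2 - q * (v * Complex.exp (-κ * y) ^ 2) =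
      μ * (Complex.exp (κ * x) * Complex.exp (-κ * y)) * a (x + y))
    (hb : ∀ x y : ℝ, q * Complex.exp (κ * x) ^ 2 - p * (v * Complex.exp (-κ * y) ^ 2) =
      μ * (Complex.exp (κ * x) * Complex.exp (-κ * y)) * b (x + y))
    (has : ∀ m : ℕ, ContDiff ℝ m a) (hbs : ∀ m : ℕ, ContDiff ℝ m b)
    (hat : 0 < a t) (hbt : 0 < b t) (hc0 : 0 < c) :
    partitionHT n ![√(a t), √(a t), √(b t), √(b t), √c, √c] =
      (a t * b t) ^ (2 * n ^ 2) / (∏ j ∈ Finset.range n, (j.factorial : ℝ) ^ 4) *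
        hankelDet n (fun s => c / (a s * b s)) t *
        hankelDet n (fun s => 1 / a s + 1 / b s) t := by
  have hF : ∏ j ∈ Finset.range n, (j.factorial : ℝ) ^ 4 ≠ 0 :=
    Finset.prod_ne_zero_iff.2 fun j _ => pow_ne_zero 4 (Nat.cast_ne_zero.2 j.factorial_ne_zero)
  rw [partitionHT_eq_homogeneousZ n hat.le hbt.le hc0.le, div_mul_eq_mul_div, div_mul_eq_mul_div,
    eq_div_iff hF]
  exact homogeneousZ_eq n h hκ hv hμ hc hc0.ne' ha hb has hbs hat.ne' hbt.ne'

theorem exp_mul_exp_neg (z : ℂ) : Complex.exp z * Complex.exp (-z) = 1 := by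
  rw [← Complex.exp_add, add_neg_cancel, Complex.exp_zero]

theorem partitionHT_ferroelectric (n : ℕ) {γ t : ℝ} {a b : ℝ → ℝ} {c : ℝ}
    (h : Ferroelectric γ t a b c) :
    partitionHT n ![√(a t), √(a t), √(b t), √(b t), √c, √c] =
      (a t * b t) ^ (2 * n ^ 2) / (∏ j ∈ Finset.range n, (j.factorial : ℝ) ^ 4) *
        hankelDet n (fun s => c / (a s * b s)) t *
        hankelDet n (fun s => 1 / a s + 1 / b s) t := by
  obtain ⟨h0, ht, rfl, rfl, rfl⟩ := h
  obtain ⟨h1, h2⟩ := abs_lt.1 ht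
  -- The sign of `γ` is irrelevant, as only `c ^ 2` enters.
  have hsq : Complex.sinh (2 * (|γ| : ℝ)) ^ 2 = Complex.sinh (2 * γ) ^ 2 := by
    rcases abs_choice γ with h | h <;> rw [h]
    rw [Complex.ofReal_neg, mul_neg, Complex.sinh_neg, neg_sq]
  refine partitionHT_eq_of_parametrization
    (a := fun s => Real.sinh (s - γ)) (b := fun s => Real.sinh (s + γ)) (c := Real.sinh (2 * |γ|))
    (p := Complex.exp (-γ)) (q := Complex.exp γ)
    (κ := 1) (v := 1) (μ := 2) n ?_ one_ne_zero one_ne_zero (by norm_num) ?_ ?_ ?_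
    (fun m => by fun_prop) (fun m => by fun_prop) (Real.sinh_pos_iff.2 (by linarith))
    (Real.sinh_pos_iff.2 (by linarith)) (Real.sinh_pos_iff.2 (by linarith))
  · rw [← Complex.exp_add, neg_add_cancel, Complex.exp_zero]
  · push_cast
    rw [hsq, two_mul (γ : ℂ), Complex.sinh, neg_add, Complex.exp_add, Complex.exp_add]
    ring
  · intro x y
    push_cast
    rw [Complex.sinh, show -((x : ℂ) + y - γ) = -x + -y + γ by ring, sub_eq_add_neg ((x : ℂ) + y),
      one_mul, show (-1 : ℂ) * (y : ℂ) = -y by ring]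
    simp only [Complex.exp_add]
    linear_combination (Complex.exp γ * Complex.exp (-(y : ℂ)) ^ 2) *
      exp_mul_exp_neg x -
      (Complex.exp (-γ) * Complex.exp x ^ 2) * exp_mul_exp_neg y
  · intro x y
    push_cast
    rw [Complex.sinh, show -((x : ℂ) + y + γ) = -x + -y + -γ by ring, one_mul,
      show (-1 : ℂ) * (y : ℂ) = -y by ring]
    simp only [Complex.exp_add]
    linear_combination (Complex.exp (-γ) * Complex.exp (-(y : ℂ)) ^ 2) *
      exp_mul_exp_neg x -
      (Complex.exp γ * Complex.exp x ^ 2) * exp_mul_exp_neg y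

theorem partitionHT_antiFerroelectric (n : ℕ) {γ t : ℝ} {a b : ℝ → ℝ} {c : ℝ}
    (h : AntiFerroelectric γ t a b c) :
    partitionHT n ![√(a t), √(a t), √(b t), √(b t), √c, √c] =
      (a t * b t) ^ (2 * n ^ 2) / (∏ j ∈ Finset.range n, (j.factorial : ℝ) ^ 4) *
        hankelDet n (fun s => c / (a s * b s)) t *
        hankelDet n (fun s => 1 / a s + 1 / b s) t := by
  obtain ⟨ht, rfl, rfl, rfl⟩ := h
  obtain ⟨h1, h2⟩ := abs_lt.1 ht
  have hI := Complex.I_sq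
  -- Compared with the ferroelectric phase, `a` changes sign relative to `b`.
  refine partitionHT_eq_of_parametrization
    (a := fun s => Real.sinh (γ - s)) (b := fun s => Real.sinh (γ + s)) (c := Real.sinh (2 * γ))
    (p := -Complex.I * Complex.exp (-γ))
    (q := Complex.I * Complex.exp γ) (κ := 1) (v := -1) (μ := 2 * Complex.I) n ?_ one_ne_zero
    (neg_ne_zero.2 one_ne_zero) ?_ ?_ ?_ ?_
    (fun m => by fun_prop) (fun m => by fun_prop) (Real.sinh_pos_iff.2 (by linarith))
    (Real.sinh_pos_iff.2 (by linarith)) (Real.sinh_pos_iff.2 (by linarith))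
  · have : Complex.exp (-(γ : ℂ)) * Complex.exp γ = 1 := by
      rw [← Complex.exp_add, neg_add_cancel, Complex.exp_zero]
    linear_combination -Complex.I ^ 2 * this - hI
  · linear_combination 4 * hI
  · push_cast
    rw [two_mul (γ : ℂ), Complex.sinh, neg_add, Complex.exp_add, Complex.exp_add]
    set P := Complex.exp (γ : ℂ)
    set Q := Complex.exp (-(γ : ℂ))
    linear_combination -(P ^ 2 - Q ^ 2) ^ 2 * Complex.I ^ 2 * hI
  · intro x y
    push_cast
    rw [Complex.sinh, show -((γ : ℂ) - (x + y)) = x + y + -γ by ring,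
      show (γ : ℂ) - (x + y) = -x + -y + γ by ring, one_mul,
      show (-1 : ℂ) * (y : ℂ) = -y by ring]
    simp only [Complex.exp_add]
    linear_combination -Complex.I * (Complex.exp γ * Complex.exp (-(y : ℂ)) ^ 2) *
      exp_mul_exp_neg x +
      Complex.I * (Complex.exp (-γ) * Complex.exp x ^ 2) * exp_mul_exp_neg y
  · intro x y
    push_cast
    rw [Complex.sinh, show -((γ : ℂ) + (x + y)) = -x + -y + -γ by ring,
      one_mul,
      show (-1 : ℂ) * (y : ℂ) = -y by ring]
    simp only [Complex.exp_add]
    linear_combination Complex.I * (Complex.exp (-γ) * Complex.exp (-(y : ℂ)) ^ 2) *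
      exp_mul_exp_neg x -
      Complex.I * (Complex.exp γ * Complex.exp x ^ 2) * exp_mul_exp_neg y

theorem partitionHT_disordered (n : ℕ) {γ t : ℝ} {a b : ℝ → ℝ} {c : ℝ}
    (h : Disordered γ t a b c) :
    partitionHT n ![√(a t), √(a t), √(b t), √(b t), √c, √c] =
      (a t * b t) ^ (2 * n ^ 2) / (∏ j ∈ Finset.range n, (j.factorial : ℝ) ^ 4) *
        hankelDet n (fun s => c / (a s * b s)) t *
        hankelDet n (fun s => 1 / a s + 1 / b s) t := by
  obtain ⟨ht, hγ, rfl, rfl, rfl⟩ := h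
  obtain ⟨h1, h2⟩ := abs_lt.1 ht
  have hI := Complex.I_sq
  -- The anti-ferroelectric parametrization with `γ` and `t` multiplied by `I`.
  refine partitionHT_eq_of_parametrization
    (a := fun s => Real.sin (γ - s)) (b := fun s => Real.sin (γ + s)) (c := Real.sin (2 * γ))
    (p := -Complex.I * Complex.exp (-γ * Complex.I))
    (q := Complex.I * Complex.exp (γ * Complex.I)) (κ := Complex.I) (v := -1) (μ := -2) n ?_
    Complex.I_ne_zero (neg_ne_zero.2 one_ne_zero) ?_ ?_ ?_ ?_
    (fun m => by fun_prop) (fun m => by fun_prop)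
    (Real.sin_pos_of_pos_of_lt_pi (by linarith) (by linarith))
    (Real.sin_pos_of_pos_of_lt_pi (by linarith) (by linarith))
    (Real.sin_pos_of_pos_of_lt_pi (by linarith) (by linarith))
  · have : Complex.exp (-(γ : ℂ) * Complex.I) * Complex.exp (γ * Complex.I) = 1 := by
      rw [← Complex.exp_add, neg_mul, neg_add_cancel, Complex.exp_zero]
    linear_combination -Complex.I ^ 2 * this - hI
  · linear_combination 4 * hI
  · push_cast
    rw [two_mul (γ : ℂ), Complex.sin, neg_add, add_mul, add_mul, Complex.exp_add, Complex.exp_add]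
    set P := Complex.exp (γ * Complex.I)
    set Q := Complex.exp (-γ * Complex.I)
    linear_combination -(P ^ 2 - Q ^ 2) ^ 2 * (Complex.I ^ 2) * hI
  · intro x y
    push_cast
    rw [Complex.sin, show -((γ : ℂ) - (x + y)) * Complex.I =
      x * Complex.I + y * Complex.I + -γ * Complex.I by ring,
      show ((γ : ℂ) - (x + y)) * Complex.I =
      -(x * Complex.I) + -(y * Complex.I) + γ * Complex.I by ring, mul_comm Complex.I (x : ℂ),
      show -Complex.I * (y : ℂ) = -(y * Complex.I) by ring]
    simp only [Complex.exp_add]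
    linear_combination -Complex.I * (Complex.exp (γ * Complex.I) *
      Complex.exp (-(y * Complex.I)) ^ 2) * exp_mul_exp_neg (x * Complex.I) +
      Complex.I * (Complex.exp (-γ * Complex.I) * Complex.exp (x * Complex.I) ^ 2) *
        exp_mul_exp_neg (y * Complex.I)
  · intro x y
    push_cast
    rw [Complex.sin, show -((γ : ℂ) + (x + y)) * Complex.I =
      -(x * Complex.I) + -(y * Complex.I) + -γ * Complex.I by ring,
      show ((γ : ℂ) + (x + y)) * Complex.I =
      x * Complex.I + y * Complex.I + γ * Complex.I by ring, mul_comm Complex.I (x : ℂ),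
      show -Complex.I * (y : ℂ) = -(y * Complex.I) by ring]
    simp only [Complex.exp_add]
    linear_combination Complex.I * (Complex.exp (-γ * Complex.I) *
      Complex.exp (-(y * Complex.I)) ^ 2) * exp_mul_exp_neg (x * Complex.I) -
      Complex.I * (Complex.exp (γ * Complex.I) * Complex.exp (x * Complex.I) ^ 2) *
        exp_mul_exp_neg (y * Complex.I)

end SixVertex

theorem proposition1p1 (n : ℕ) (γ t : ℝ) (a b : ℝ → ℝ) (c : ℝ)
    (hphase : SixVertex.Ferroelectric γ t a b c ∨ SixVertex.AntiFerroelectric γ t a b c ∨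
      SixVertex.Disordered γ t a b c) :
    SixVertex.partitionHT n ![√(a t), √(a t), √(b t), √(b t), √c, √c] =
      (a t * b t) ^ (2 * n ^ 2) / (∏ j ∈ Finset.range n, (j.factorial : ℝ) ^ 4) *
        SixVertex.hankelDet n (fun s => c / (a s * b s)) t *
        SixVertex.hankelDet n (fun s => 1 / a s + 1 / b s) t := by
  rcases hphase with h | h | h
  · exact SixVertex.partitionHT_ferroelectric n h
  · exact SixVertex.partitionHT_antiFerroelectric n h
  · exact SixVertex.partitionHT_disordered n h
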